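/- For a real matrix $M$ with singular values $\sigma_1(M)\ge\sigma_2(M)\ge\cdots$ and real $p\ge1$, let $\|M\|_p=\bigl(\sum_{i\le \operatorname{rank}M}\sigma_i(M)^p\bigr)^{1/p}$ be its Schatten $p$-norm. There are absolute constants $\theta\in(0,1)$, $c\ge1$, $c''>0$ and a positive integer $K$ such that the following holds. For all real $p,q\ge1$ such that $p,q\le 2$ or $p,q\ge2$ there is a constant $C=C(p,q)>0$ such that for all positive integers $n,t$ with $c\log n\le t\le\theta n$ there is a variance $v>0$ (depending only on $p,q,n,t$) for which the random $r\times n$ matrix $G$ with $r=Kt$ rows and i.i.d. $N(0,v)$ entries satisfies: for every fixed real matrix $A$ with $n$ rows (and any number of columns), with probability at least $1-\exp(-c''t)$, \[ \|A\|_p\;\le\;\|GA\|_q\;\le\; C\,\tilde D_{p,q}\,\Bigl(\log\frac nt\Bigr)\,\|A\|_p , \] where \[ \tilde D_{p,q}=\begin{cases} n^{\frac1p-\frac12}/t^{\frac1q-\frac12}, & 1\le p\le q\le2,\\ \max\{(n/t)^{\frac1p-\frac12},\,t^{\frac1q-\frac1p}\}, & 1\le q\le p\le2,\\ \max\{(n/t)^{\frac12-\frac1p},\,t^{\frac1p-\frac1q}\},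 & 2\le p\le q,\\ n^{\frac12-\frac1p}/t^{\frac12-\frac1q}, & 2\le q\le p \end{cases} \] (the formulas agree where the cases overlap). In particular, for $p=q$ the bound is $\|A\|_p\le\|GA\|_p\le C\,(n/t)^{|\frac1p-\frac12|}\,\log(n/t)\,\|A\|_p$. -/

import Mathlib

open MeasureTheory ProbabilityTheory
open scoped NNReal

/-- The Schatten `p`-norm `(∑_{i ≤ rank A} σ_i(A)^p)^{1/p}` of a real matrix, where
`σ_1(A) ≥ σ_2(A) ≥ ⋯` are its singular values (indexed from `0` in Mathlib). -/
noncomputable def schattenNorm {m d : ℕ} (p : ℝ) (A : Matrix (Fin m) (Fin d) ℝ) : ℝ :=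
  (∑ i ∈ Finset.range A.rank, (Matrix.toEuclideanLin A).singularValues i ^ p) ^ (1 / p)

/-- The law of an `r × n` random matrix with i.i.d. `N(0, v)` entries, as a measure on arrays. -/
noncomputable def gaussianMatrixLaw (r n : ℕ) (v : ℝ≥0) : Measure (Fin r → Fin n → ℝ) :=
  Measure.pi fun _ => Measure.pi fun _ => gaussianReal 0 v

/-- A law `μ` on `r × n` matrices `G` is an oblivious sketch from Schatten-`p` to Schatten-`q` with
distortion `D` and failure probability `δ`: for every fixed matrix `A` with `n` rows,
`‖A‖_p ≤ ‖GA‖_q ≤ D ‖A‖_p` holds with probability at least `1 - δ`. -/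
def IsObliviousSketch {r n : ℕ} (μ : Measure (Fin r → Fin n → ℝ)) (p q D δ : ℝ) : Prop :=
  ∀ (d : ℕ) (A : Matrix (Fin n) (Fin d) ℝ),
    1 - δ ≤ μ.real {G | schattenNorm p A ≤ schattenNorm q (Matrix.of G * A) ∧
      schattenNorm q (Matrix.of G * A) ≤ D * schattenNorm p A}

/-!
A Gaussian matrix `G` with `r = O(t)` rows does not distort Schatten norms much because, for a
fixed matrix `A` with singular values `σ 0 ≥ σ 1 ≥ ⋯`, the norm `‖G A‖_q` is determined up to
constant factors. With probability at least `1 - exp (-t)`, for variance `1`,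

  `‖G A‖_q ≍ √t * (∑ i < t, σ i ^ q) ^ (1 / q) + t ^ (1 / q) * (∑ i ≥ t, σ i ^ 2) ^ (1 / 2)`,

the right-hand side being `sketchSize`; this is `measure_not_schattenNorm_comparable_le`. Comparing
it with the `ℓ_p` norm of `σ` takes only Hölder's inequality and interpolation (the lemmas
`sketchSize_bounds_…`), and the ratio of the two extreme constants is the claimed distortion. The
variance is chosen so that the lower constant becomes `1`. The logarithmic factor of the statement
is at least `1` and is not needed.

The formula for `‖G A‖_q` rests on three properties of `G`. On the span of the top `t` left
singular vectors of `A`, `G` is `√r` times an isometry up to constants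
(`measure_not_subspace_embedding_le`). On the span of the remaining right singular vectors, where
the Frobenius norm of `A` is `T`, the operator norm of `G A` is at most of the order of
`T + √r * σ t` (`measure_not_norm_sum_smul_le`). Finally, `G` does not shrink any left singular
vector by much below `√r`, so the Frobenius norm of `G A` on the tail is at least of the order of
`√r * T`. All three follow from exponential moments of Gaussian quadratic forms, together with
union bounds over nets of unit balls, which are provided by the volume bound of the Besicovitch
covering theorem.

The first two properties bound the singular values of `G A` from above, and the first `t` of them
from below, through the Courant–Fischer principle. For the contribution of the tail to the lower
bound one restricts `G A` to the span of the tail: either `T ≤ √t * σ t`, and the tail is dominated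
by the head, or all singular values of the restriction are `O(T)` while their squares sum to at
least a multiple of `t * T ^ 2`, so that a positive proportion of them is of the order of `T`
(`sketchSize_le_finsetNorm`).
-/

/-! ### Singular values and the Courant–Fischer principle -/

section SingularValues

open Module InnerProductSpace

variable {E : Type*} [NormedAddCommGroup E] [InnerProductSpace ℝ E]
  {F : Type*} [NormedAddCommGroup F] [InnerProductSpace ℝ F] [FiniteDimensional ℝ F]

/-- The span of the vectors of an orthonormal basis whose index satisfies `P`. -/
def coordSpan {d : ℕ} (b : OrthonormalBasis (Fin d) ℝ E) (P : Set (Fin d)) : Submodule ℝ E :=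
  Submodule.span ℝ (Set.range fun j : P => b j)

theorem finrank_coordSpan {d : ℕ} (b : OrthonormalBasis (Fin d) ℝ E) (P : Set (Fin d))
    [Fintype P] : finrank ℝ (coordSpan b P) = Fintype.card P :=
  finrank_span_eq_card (b.orthonormal.linearIndependent.comp _ Subtype.val_injective)

theorem inner_eq_zero_of_mem_coordSpan {d : ℕ} (b : OrthonormalBasis (Fin d) ℝ E)
    (P : Set (Fin d)) {x : E} (hx : x ∈ coordSpan b P) {j : Fin d} (hj : j ∉ P) :
    ⟪b j, x⟫_ℝ = 0 := by
  induction hx using Submodule.span_induction with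
  | mem x h =>
    obtain ⟨i, rfl⟩ := h
    exact b.inner_eq_zero fun h => hj (h ▸ i.2)
  | zero => simp
  | add x y _ _ hx hy => simp [inner_add_right, hx, hy]
  | smul a x _ hx => simp [inner_smul_right, hx]

theorem sum_sq_inner (d : ℕ) (b : OrthonormalBasis (Fin d) ℝ E) (x : E) :
    ∑ j, ⟪b j, x⟫_ℝ ^ 2 = ‖x‖ ^ 2 := by
  simpa using b.sum_sq_norm_inner_right x

theorem finrank_coordSpan_ge {d : ℕ} (b : OrthonormalBasis (Fin d) ℝ E) (i : ℕ) :
    finrank ℝ (coordSpan b {j | i ≤ (j : ℕ)}) = d - i := by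
  classical
  rw [finrank_coordSpan]
  simp only [Set.coe_ofPred, Fintype.card_subtype]
  have := Finset.card_filter_add_card_filter_not (s := (Finset.univ : Finset (Fin d)))
    (fun j : Fin d => (j : ℕ) < i)
  rw [Fin.card_filter_val_lt] at this
  simp only [not_lt, Finset.card_univ, Fintype.card_fin] at this
  omega

theorem finrank_coordSpan_lt {d : ℕ} (b : OrthonormalBasis (Fin d) ℝ E) (i : ℕ) :
    finrank ℝ (coordSpan b {j | (j : ℕ) < i}) = min d i := by
  classical
  rw [finrank_coordSpan]
  simp only [Set.coe_ofPred, Fintype.card_subtype]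
  rw [Fin.card_filter_val_lt]

theorem mem_coordSpan_of_inner_eq_zero {d : ℕ} (b : OrthonormalBasis (Fin d) ℝ E)
    (P : Set (Fin d)) {x : E} (hx : ∀ j ∉ P, ⟪b j, x⟫_ℝ = 0) : x ∈ coordSpan b P := by
  rw [← b.sum_repr' x]
  refine Submodule.sum_mem _ fun j _ => ?_
  by_cases hj : j ∈ P
  · exact Submodule.smul_mem _ _ (Submodule.subset_span ⟨⟨j, hj⟩, rfl⟩)
  · rw [hx j hj, zero_smul]
    exact Submodule.zero_mem _

theorem coordSpan_mono {d : ℕ} (b : OrthonormalBasis (Fin d) ℝ E) {P Q : Set (Fin d)}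
    (h : P ⊆ Q) : coordSpan b P ≤ coordSpan b Q := fun _ hx =>
  mem_coordSpan_of_inner_eq_zero b Q fun _ hj =>
    inner_eq_zero_of_mem_coordSpan b P hx fun hP => hj (h hP)

/-- The decomposition of a vector into the part with coordinates in `P` and the remainder. -/
theorem exists_add_of_coordSpan {d : ℕ} (b : OrthonormalBasis (Fin d) ℝ E) (P Q : Set (Fin d))
    {x : E} (hx : x ∈ coordSpan b Q) : ∃ y z, x = y + z ∧ y ∈ coordSpan b (P ∩ Q) ∧
      z ∈ coordSpan b Pᶜ ∧ ‖y‖ ≤ ‖x‖ ∧ ‖z‖ ≤ ‖x‖ := by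
  classical
  have hy : ∀ k, ⟪b k, ∑ j, (if j ∈ P then ⟪b j, x⟫_ℝ else 0) • b j⟫_ℝ =
      if k ∈ P then ⟪b k, x⟫_ℝ else 0 := fun k => by
    simp only [inner_sum, real_inner_smul_right, b.inner_eq_ite]
    simp
  refine ⟨∑ j, (if j ∈ P then ⟪b j, x⟫_ℝ else 0) • b j,
    x - ∑ j, (if j ∈ P then ⟪b j, x⟫_ℝ else 0) • b j, by abel, ?_, ?_, ?_, ?_⟩
  · refine mem_coordSpan_of_inner_eq_zero _ _ fun k hk => ?_
    rw [hy]
    split_ifs with h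
    · exact inner_eq_zero_of_mem_coordSpan b Q hx fun hQ => hk ⟨h, hQ⟩
    · rfl
  · refine mem_coordSpan_of_inner_eq_zero _ _ fun k hk => ?_
    rw [inner_sub_right, hy, if_pos (by simpa using hk), sub_self]
  all_goals
    refine (sq_le_sq₀ (norm_nonneg _) (norm_nonneg _)).1 ?_
    rw [← sum_sq_inner d b, ← sum_sq_inner d b x]
    refine Finset.sum_le_sum fun k _ => ?_
    simp only [inner_sub_right, hy]
    split_ifs <;> simp [sq_nonneg]

variable [FiniteDimensional ℝ E]

/-- An orthonormal basis of right singular vectors of `T`, ordered by decreasing singular value. -/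
noncomputable def rightSingularBasis {d : ℕ} (T : E →ₗ[ℝ] F) (hd : finrank ℝ E = d) :
    OrthonormalBasis (Fin d) ℝ E :=
  T.isSymmetric_adjoint_comp_self.eigenvectorBasis hd

theorem inner_map_rightSingularBasis {d : ℕ} (T : E →ₗ[ℝ] F) (hd : finrank ℝ E = d)
    (j : Fin d) (x : E) :
    ⟪T (rightSingularBasis T hd j), T x⟫_ℝ =
      T.singularValues j ^ 2 * ⟪rightSingularBasis T hd j, x⟫_ℝ := by
  rw [← LinearMap.adjoint_inner_left, T.sq_singularValues_fin hd]
  have := T.isSymmetric_adjoint_comp_self.apply_eigenvectorBasis hd j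
  rw [LinearMap.comp_apply] at this
  rw [rightSingularBasis, this, real_inner_smul_left]
  rfl

theorem norm_map_rightSingularBasis {d : ℕ} (T : E →ₗ[ℝ] F) (hd : finrank ℝ E = d)
    (j : Fin d) : ‖T (rightSingularBasis T hd j)‖ = T.singularValues j := by
  have h := inner_map_rightSingularBasis T hd j (rightSingularBasis T hd j)
  rw [real_inner_self_eq_norm_sq, real_inner_self_eq_norm_sq,
    (rightSingularBasis T hd).norm_eq_one] at h
  exact (sq_eq_sq₀ (norm_nonneg _) (T.singularValues_nonneg _)).1 (by simpa using h)

theorem inner_map_rightSingularBasis_of_ne {d : ℕ} (T : E →ₗ[ℝ] F) (hd : finrank ℝ E = d)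
    {i j : Fin d} (hij : i ≠ j) :
    ⟪T (rightSingularBasis T hd i), T (rightSingularBasis T hd j)⟫_ℝ = 0 := by
  rw [inner_map_rightSingularBasis, (rightSingularBasis T hd).inner_eq_zero hij, mul_zero]

theorem norm_map_sq_eq_sum_singularValues {d : ℕ} (T : E →ₗ[ℝ] F) (hd : finrank ℝ E = d)
    (x : E) :
    ‖T x‖ ^ 2 = ∑ j : Fin d, T.singularValues j ^ 2 * ⟪rightSingularBasis T hd j, x⟫_ℝ ^ 2 := by
  rw [← real_inner_self_eq_norm_sq, ← LinearMap.adjoint_inner_left,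
    ← (rightSingularBasis T hd).sum_inner_mul_inner]
  refine Finset.sum_congr rfl fun j _ => ?_
  rw [LinearMap.adjoint_inner_left, real_inner_comm, inner_map_rightSingularBasis]
  ring

/-- On the span of the right singular vectors of index at least `i`, the operator `T` expands
norms by at most its `i`-th singular value. -/
theorem norm_map_le_of_mem_coordSpan {d : ℕ} (T : E →ₗ[ℝ] F) (hd : finrank ℝ E = d) (i : ℕ)
    {x : E} (hx : x ∈ coordSpan (rightSingularBasis T hd) {j | i ≤ j}) :
    ‖T x‖ ≤ T.singularValues i * ‖x‖ := by
  refine (sq_le_sq₀ (norm_nonneg _)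
    (mul_nonneg (T.singularValues_nonneg _) (norm_nonneg _))).1 ?_
  rw [norm_map_sq_eq_sum_singularValues T hd, mul_pow, ← sum_sq_inner d (rightSingularBasis T hd) x,
    Finset.mul_sum]
  refine Finset.sum_le_sum fun j _ => ?_
  by_cases hj : i ≤ (j : ℕ)
  · gcongr
    · exact T.singularValues_nonneg _
    · exact T.singularValues_antitone hj
  · rw [inner_eq_zero_of_mem_coordSpan _ _ hx (by simpa using hj)]
    simp

/-- On the span of the right singular vectors of index at most `i`, the operator `T` expands
norms by at least its `i`-th singular value. -/
theorem le_norm_map_of_mem_coordSpan {d : ℕ} (T : E →ₗ[ℝ] F) (hd : finrank ℝ E = d) (i : ℕ)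
    {x : E} (hx : x ∈ coordSpan (rightSingularBasis T hd) {j | (j : ℕ) ≤ i}) :
    T.singularValues i * ‖x‖ ≤ ‖T x‖ := by
  refine (sq_le_sq₀ (mul_nonneg (T.singularValues_nonneg _) (norm_nonneg _))
    (norm_nonneg _)).1 ?_
  rw [norm_map_sq_eq_sum_singularValues T hd, mul_pow, ← sum_sq_inner d (rightSingularBasis T hd) x,
    Finset.mul_sum]
  refine Finset.sum_le_sum fun j _ => ?_
  by_cases hj : (j : ℕ) ≤ i
  · gcongr
    · exact T.singularValues_nonneg _
    · exact T.singularValues_antitone hj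
  · rw [inner_eq_zero_of_mem_coordSpan _ _ hx (by simpa using hj)]
    simp

theorem exists_ne_zero_mem_inf {V W : Submodule ℝ E}
    (h : finrank ℝ E < finrank ℝ V + finrank ℝ W) : ∃ x ∈ V, x ∈ W ∧ x ≠ 0 := by
  have h1 := Submodule.finrank_sup_add_finrank_inf_eq V W
  have h2 := Submodule.finrank_le (V ⊔ W)
  have h3 : V ⊓ W ≠ ⊥ := by
    intro h0
    rw [h0, finrank_bot] at h1
    omega
  obtain ⟨x, hx, h0⟩ := Submodule.exists_mem_ne_zero_of_ne_bot h3
  exact ⟨x, hx.1, hx.2, h0⟩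

/-- The upper half of the Courant–Fischer principle. -/
theorem singularValues_le_of_forall_norm_le (T : E →ₗ[ℝ] F) (V : Submodule ℝ E) {i : ℕ} {b : ℝ}
    (hb : 0 ≤ b) (hV : finrank ℝ E ≤ finrank ℝ V + i) (h : ∀ x ∈ V, ‖T x‖ ≤ b * ‖x‖) :
    T.singularValues i ≤ b := by
  rcases le_or_gt (finrank ℝ E) i with hi | hi
  · rwa [T.singularValues_of_finrank_le hi]
  obtain ⟨x, hxV, hxW, hx0⟩ := exists_ne_zero_mem_inf (V := V)
    (W := coordSpan (rightSingularBasis T rfl) {j | (j : ℕ) < i + 1})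
    (by rw [finrank_coordSpan_lt]; omega)
  have h1 := le_norm_map_of_mem_coordSpan T rfl i (x := x) (by simpa [Nat.lt_succ_iff] using hxW)
  exact le_of_mul_le_mul_right (h1.trans (h x hxV)) (norm_pos_iff.2 hx0)

/-- The lower half of the Courant–Fischer principle. -/
theorem le_singularValues_of_forall_le_norm (T : E →ₗ[ℝ] F) (V : Submodule ℝ E) {i : ℕ} {b : ℝ}
    (hV : i < finrank ℝ V) (h : ∀ x ∈ V, b * ‖x‖ ≤ ‖T x‖) :
    b ≤ T.singularValues i := by
  have hle := Submodule.finrank_le V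
  obtain ⟨x, hxV, hxW, hx0⟩ := exists_ne_zero_mem_inf (V := V)
    (W := coordSpan (rightSingularBasis T rfl) {j | i ≤ (j : ℕ)})
    (by rw [finrank_coordSpan_ge]; omega)
  have h1 := norm_map_le_of_mem_coordSpan T rfl i (x := x) hxW
  exact le_of_mul_le_mul_right ((h x hxV).trans h1) (norm_pos_iff.2 hx0)

theorem singularValues_domRestrict_le (T : E →ₗ[ℝ] F) (V : Submodule ℝ E) (i : ℕ) :
    (T.domRestrict V).singularValues i ≤ T.singularValues i := by
  rcases le_or_gt (finrank ℝ V) i with hi | hi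
  · rw [LinearMap.singularValues_of_finrank_le _ hi]
    exact T.singularValues_nonneg i
  set S := T.domRestrict V
  refine le_singularValues_of_forall_le_norm T
    ((coordSpan (rightSingularBasis S rfl) {j | (j : ℕ) < i + 1}).map V.subtype) ?_ ?_
  · rw [Submodule.finrank_map_subtype_eq, finrank_coordSpan_lt]
    omega
  · rintro _ ⟨y, hy, rfl⟩
    exact le_norm_map_of_mem_coordSpan S rfl i (x := y) (by simpa [Nat.lt_succ_iff] using hy)

theorem singularValues_smul_le (T : E →ₗ[ℝ] F) (c : ℝ) (i : ℕ) :
    (c • T).singularValues i ≤ |c| * T.singularValues i := by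
  refine singularValues_le_of_forall_norm_le _
    (coordSpan (rightSingularBasis T rfl) {j | i ≤ (j : ℕ)})
    (mul_nonneg (abs_nonneg _) (T.singularValues_nonneg _)) ?_ fun x hx => ?_
  · rw [finrank_coordSpan_ge]; omega
  · rw [LinearMap.smul_apply, norm_smul, Real.norm_eq_abs, mul_assoc]
    gcongr
    exact norm_map_le_of_mem_coordSpan T rfl i hx

theorem singularValues_smul (T : E →ₗ[ℝ] F) {c : ℝ} (hc : 0 < c) (i : ℕ) :
    (c • T).singularValues i = c * T.singularValues i := by
  refine le_antisymm (by simpa [abs_of_pos hc] using singularValues_smul_le T c i) ?_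
  have h := singularValues_smul_le (c • T) c⁻¹ i
  rw [smul_smul, inv_mul_cancel₀ hc.ne', one_smul, abs_of_pos (inv_pos.2 hc)] at h
  rwa [← le_inv_mul_iff₀ hc]

/-- The squares of the singular values add up to the squared Frobenius norm. -/
theorem sum_sq_singularValues {ι : Type*} [Fintype ι] (T : E →ₗ[ℝ] F)
    (b : OrthonormalBasis ι ℝ E) {m : ℕ} (hm : finrank ℝ (LinearMap.range T) ≤ m) :
    ∑ i ∈ Finset.range m, T.singularValues i ^ 2 = ∑ j, ‖T (b j)‖ ^ 2 := by
  have h1 := LinearMap.trace_eq_sum_inner (LinearMap.adjoint T ∘ₗ T) b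
  have h2 := T.isSymmetric_adjoint_comp_self.trace_eq_sum_eigenvalues rfl
  have h3 : ∀ k, finrank ℝ (LinearMap.range T) ≤ k →
      ∑ i ∈ Finset.range k, T.singularValues i ^ 2 =
        ∑ i ∈ Finset.range (finrank ℝ (LinearMap.range T)), T.singularValues i ^ 2 := by
    intro k hk
    refine (Finset.sum_subset (Finset.range_mono hk) fun i _ hi => ?_).symm
    rw [T.singularValues_eq_zero_iff_le_finrank_range.2 (by simpa using hi)]
    simp
  rw [h3 m hm, ← h3 _ (LinearMap.finrank_range_le T), Finset.sum_range]
  simp_rw [T.sq_singularValues_fin rfl]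
  rw [h1] at h2
  simp only [RCLike.ofReal_real_eq_id, id] at h2
  rw [← h2]
  refine Finset.sum_congr rfl fun j _ => ?_
  rw [LinearMap.comp_apply, LinearMap.adjoint_inner_right, real_inner_self_eq_norm_sq]

end SingularValues

/-! ### Schatten norms -/

theorem finrank_range_toEuclideanLin {m d : ℕ} (A : Matrix (Fin m) (Fin d) ℝ) :
    Module.finrank ℝ (LinearMap.range (Matrix.toEuclideanLin A)) = A.rank := by
  rw [Matrix.rank_eq_finrank_range_toLin A (EuclideanSpace.basisFun _ ℝ).toBasis
    (EuclideanSpace.basisFun _ ℝ).toBasis]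
  rfl

/-- The `ℓ_p` norm of the family `(f i)_{i ∈ s}` of nonnegative numbers. -/
noncomputable def finsetNorm (p : ℝ) (s : Finset ℕ) (f : ℕ → ℝ) : ℝ :=
  (∑ i ∈ s, f i ^ p) ^ (1 / p)

theorem schattenNorm_eq_finsetNorm {m d : ℕ} {p : ℝ} (hp : 1 ≤ p) (A : Matrix (Fin m) (Fin d) ℝ)
    {k : ℕ} (hk : A.rank ≤ k) :
    schattenNorm p A = finsetNorm p (Finset.range k) (Matrix.toEuclideanLin A).singularValues := by
  unfold schattenNorm finsetNorm
  congr 1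
  refine Finset.sum_subset (Finset.range_mono hk) fun i _ hi => ?_
  rw [(LinearMap.singularValues_eq_zero_iff_le_finrank_range _).2
    (by rw [finrank_range_toEuclideanLin]; simpa using hi), Real.zero_rpow (by linarith)]

theorem schattenNorm_smul {m d : ℕ} {p : ℝ} (hp : 1 ≤ p) (A : Matrix (Fin m) (Fin d) ℝ)
    {c : ℝ} (hc : 0 < c) : schattenNorm p (c • A) = c * schattenNorm p A := by
  rw [schattenNorm_eq_finsetNorm hp _ (Matrix.rank_le_height _),
    schattenNorm_eq_finsetNorm hp _ (Matrix.rank_le_height _)]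
  unfold finsetNorm
  simp_rw [map_smul, singularValues_smul _ hc]
  have h0 : ∀ i, 0 ≤ (Matrix.toEuclideanLin A).singularValues i :=
    LinearMap.singularValues_nonneg _
  simp_rw [Real.mul_rpow hc.le (h0 _)]
  rw [← Finset.mul_sum, Real.mul_rpow (by positivity)
    (Finset.sum_nonneg fun i _ => Real.rpow_nonneg (h0 i) _), ← Real.rpow_mul hc.le,
    mul_one_div_cancel (by linarith), Real.rpow_one]

/-! ### Nets of the unit ball -/

section Nets

open Module

theorem exists_half_net_of_unit_ball (E : Type*) [NormedAddCommGroup E] [NormedSpace ℝ E]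
    [FiniteDimensional ℝ E] : ∃ N : Finset E, N.card ≤ 5 ^ finrank ℝ E ∧ (∀ y ∈ N, ‖y‖ ≤ 1) ∧
      ∀ x : E, ‖x‖ ≤ 1 → ∃ y ∈ N, ‖x - y‖ ≤ 1 / 2 := by
  classical
  -- A separated subset of the ball of radius `2` of maximal cardinality, scaled by `1 / 2`.
  let P : Finset E → Prop := fun s =>
    (∀ c ∈ s, ‖c‖ ≤ 2) ∧ ∀ c ∈ s, ∀ d ∈ s, c ≠ d → 1 ≤ ‖c - d‖
  let S : Set ℕ := {k | ∃ s : Finset E, P s ∧ s.card = k}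
  have hS0 : S.Nonempty := ⟨0, ∅, ⟨by simp, by simp⟩, rfl⟩
  have hSb : BddAbove S := ⟨5 ^ finrank ℝ E, by
    rintro _ ⟨s, hs, rfl⟩
    exact Besicovitch.card_le_of_separated s hs.1 hs.2⟩
  obtain ⟨s, hs, hcard⟩ := Nat.sSup_mem hS0 hSb
  refine ⟨s.image fun y => (1 / 2 : ℝ) • y, Finset.card_image_le.trans
    (Besicovitch.card_le_of_separated s hs.1 hs.2), ?_, fun x hx => ?_⟩
  · intro y hy
    obtain ⟨z, hz, rfl⟩ := Finset.mem_image.1 hy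
    have := hs.1 z hz
    rw [norm_smul, Real.norm_of_nonneg (by norm_num)]
    linarith
  · by_contra! hfar
    have hsep : ∀ z ∈ s, 1 < ‖(2 : ℝ) • x - z‖ := by
      intro z hz
      have h := hfar _ (Finset.mem_image_of_mem _ hz)
      have h2 : (2 : ℝ) • x - z = (2 : ℝ) • (x - (1 / 2 : ℝ) • z) := by
        rw [smul_sub, smul_smul]; norm_num
      rw [h2, norm_smul, Real.norm_of_nonneg (by norm_num)]
      linarith
    have hnot : (2 : ℝ) • x ∉ s := fun h => by
      have := hsep _ h
      simp at this
      linarith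
    have hP : P (insert ((2 : ℝ) • x) s) := by
      refine ⟨fun c hc => ?_, fun c hc d hd hcd => ?_⟩
      · rcases Finset.mem_insert.1 hc with rfl | hc
        · rw [norm_smul, Real.norm_of_nonneg (by norm_num)]; linarith
        · exact hs.1 c hc
      · rcases Finset.mem_insert.1 hc with rfl | hc <;> rcases Finset.mem_insert.1 hd with rfl | hd
        · exact absurd rfl hcd
        · exact (hsep _ hd).le
        · rw [norm_sub_rev]; exact (hsep _ hc).le
        · exact hs.2 c hc d hd hcd
    have := le_csSup hSb ⟨_, hP, rfl⟩
    rw [Finset.card_insert_of_notMem hnot] at this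
    omega

theorem exists_net_of_unit_ball (E : Type*) [NormedAddCommGroup E] [NormedSpace ℝ E]
    [FiniteDimensional ℝ E] (k : ℕ) : ∃ N : Finset E, N.card ≤ (5 ^ finrank ℝ E) ^ k ∧
      ∀ x : E, ‖x‖ ≤ 1 → ∃ y ∈ N, ‖x - y‖ ≤ (1 / 2) ^ k := by
  classical
  induction k with
  | zero => exact ⟨{0}, by simp, fun x hx => ⟨0, by simp, by simpa using hx⟩⟩
  | succ k ih =>
    obtain ⟨N, hN, hcov⟩ := ih
    obtain ⟨N₁, hN₁, -, hcov₁⟩ := exists_half_net_of_unit_ball E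
    refine ⟨Finset.image₂ (fun y z => y + (1 / 2 : ℝ) ^ k • z) N N₁, ?_, fun x hx => ?_⟩
    · rw [pow_succ]
      exact (Finset.card_image₂_le _ _ _).trans (Nat.mul_le_mul hN hN₁)
    · obtain ⟨y, hy, hxy⟩ := hcov x hx
      obtain ⟨z, hz, hxz⟩ := hcov₁ ((2 : ℝ) ^ k • (x - y)) (by
        rw [norm_smul, Real.norm_of_nonneg (by positivity)]
        calc (2 : ℝ) ^ k * ‖x - y‖ ≤ 2 ^ k * (1 / 2) ^ k := by gcongr
          _ = 1 := by rw [← mul_pow]; norm_num)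
      refine ⟨_, Finset.mem_image₂_of_mem hy hz, ?_⟩
      have h : x - (y + (1 / 2 : ℝ) ^ k • z) = (1 / 2 : ℝ) ^ k • ((2 : ℝ) ^ k • (x - y) - z) := by
        rw [smul_sub, smul_smul, ← mul_pow]
        norm_num
        abel
      rw [h, norm_smul, Real.norm_of_nonneg (by positivity), pow_succ]
      gcongr

/-- A bound for a linear map on an `ε`-net of the unit ball controls its operator norm. -/
theorem opNorm_le_of_net {E F : Type*} [NormedAddCommGroup E] [NormedSpace ℝ E]
    [NormedAddCommGroup F] [NormedSpace ℝ F]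
    (L : E →L[ℝ] F) {N : Finset E} {ε a : ℝ} (hε : 0 ≤ ε) (ha : 0 ≤ a)
    (hN : ∀ x : E, ‖x‖ = 1 → ∃ y ∈ N, ‖x - y‖ ≤ ε ∧ ‖L y‖ ≤ a) :
    ‖L‖ ≤ a + ‖L‖ * ε := by
  refine L.opNorm_le_of_unit_norm (by positivity) fun x hx => ?_
  obtain ⟨y, -, hxy, hy⟩ := hN x hx
  calc ‖L x‖ = ‖L y + L (x - y)‖ := by rw [map_sub]; congr 1; abel
    _ ≤ ‖L y‖ + ‖L (x - y)‖ := norm_add_le _ _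
    _ ≤ a + ‖L‖ * ε := by
      gcongr
      exact (L.le_opNorm _).trans (by gcongr)

end Nets

/-! ### Gaussian exponential integrals -/

section Gaussian

theorem lintegral_pi_prod {ι : Type*} [Fintype ι] {X : ι → Type*} [∀ i, MeasurableSpace (X i)]
    (μ : ∀ i, Measure (X i)) [∀ i, IsProbabilityMeasure (μ i)] (f : ∀ i, X i → ENNReal)
    (hf : ∀ i, Measurable (f i)) :
    ∫⁻ x, ∏ i, f i (x i) ∂Measure.pi μ = ∏ i, ∫⁻ y, f i y ∂μ i := by
  refine (lintegral_prod_eq_prod_lintegral_of_indepFun Finset.univ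
    (fun i (x : ∀ i, X i) => f i (x i)) (iIndepFun_pi fun i => (hf i).aemeasurable)
    fun i => (hf i).comp (measurable_pi_apply i)).trans ?_
  refine Finset.prod_congr rfl fun i _ => ?_
  rw [← (measurePreserving_eval μ i).lintegral_comp (hf i)]

/-- The exponential moments of the square of a standard Gaussian variable. -/
theorem lintegral_exp_mul_sq_gaussianReal {c : ℝ} (hc : c < 1 / 2) :
    ∫⁻ x, ENNReal.ofReal (Real.exp (c * x ^ 2)) ∂gaussianReal 0 1 =
      ENNReal.ofReal (1 / √(1 - 2 * c)) := by
  rw [gaussianReal_of_var_ne_zero 0 one_ne_zero,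
    lintegral_withDensity_eq_lintegral_mul _ (measurable_gaussianPDF 0 1) (by fun_prop)]
  have h1 : ∀ x : ℝ, (gaussianPDF 0 1 * fun x => ENNReal.ofReal (Real.exp (c * x ^ 2))) x =
      ENNReal.ofReal ((√(2 * Real.pi))⁻¹ * Real.exp (-(1 / 2 - c) * x ^ 2)) := by
    intro x
    rw [Pi.mul_apply, gaussianPDF, ← ENNReal.ofReal_mul (gaussianPDFReal_nonneg _ _ _),
      gaussianPDFReal, mul_assoc, ← Real.exp_add]
    congr 2
    · simp
    · congr 1
      simp only [NNReal.coe_one]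
      ring
  simp_rw [h1]
  rw [← ofReal_integral_eq_lintegral_ofReal
    ((integrable_exp_neg_mul_sq (by linarith)).const_mul _)
    (Filter.Eventually.of_forall fun x => by positivity), integral_const_mul, integral_gaussian]
  congr 1
  have hpos : 0 < 1 - 2 * c := by linarith
  rw [show Real.pi / (1 / 2 - c) = 2 * Real.pi / (1 - 2 * c) by field_simp,
    Real.sqrt_div (by positivity)]
  field_simp

theorem lintegral_exp_mul_gaussianReal (a : ℝ) :
    ∫⁻ x, ENNReal.ofReal (Real.exp (a * x)) ∂gaussianReal 0 1 =
      ENNReal.ofReal (Real.exp (a ^ 2 / 2)) := by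
  rw [← ofReal_integral_eq_lintegral_ofReal (integrable_exp_mul_gaussianReal a)
    (Filter.Eventually.of_forall fun x => by positivity)]
  congr 1
  have := congrFun (mgf_id_gaussianReal (μ := 0) (v := 1)) a
  simpa [mgf] using this

theorem lintegral_exp_sum_mul_pi {ι : Type*} [Fintype ι] (a : ι → ℝ) :
    ∫⁻ x, ENNReal.ofReal (Real.exp (∑ i, a i * x i)) ∂Measure.pi (fun _ : ι => gaussianReal 0 1) =
      ENNReal.ofReal (Real.exp ((∑ i, a i ^ 2) / 2)) := by
  simp_rw [Real.exp_sum, ENNReal.ofReal_prod_of_nonneg fun i _ => (Real.exp_pos _).le]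
  rw [lintegral_pi_prod (fun _ : ι => gaussianReal 0 1)
    (fun i y => ENNReal.ofReal (Real.exp (a i * y))) (fun i => by fun_prop)]
  simp_rw [lintegral_exp_mul_gaussianReal]
  rw [← ENNReal.ofReal_prod_of_nonneg fun i _ => (Real.exp_pos _).le, ← Real.exp_sum,
    Finset.sum_div]

theorem lintegral_exp_sum_mul_gaussianMatrixLaw {r n : ℕ} (B : Fin r → Fin n → ℝ) :
    ∫⁻ G, ENNReal.ofReal (Real.exp (∑ k, ∑ l, B k l * G k l)) ∂gaussianMatrixLaw r n 1 =
      ENNReal.ofReal (Real.exp ((∑ k, ∑ l, B k l ^ 2) / 2)) := by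
  have h1 : ∀ G : Fin r → Fin n → ℝ, ENNReal.ofReal (Real.exp (∑ k, ∑ l, B k l * G k l)) =
      ∏ k, ENNReal.ofReal (Real.exp (∑ l, B k l * G k l)) := fun G => by
    rw [Real.exp_sum, ENNReal.ofReal_prod_of_nonneg fun i _ => (Real.exp_pos _).le]
  unfold gaussianMatrixLaw
  simp_rw [h1]
  rw [lintegral_pi_prod (fun _ : Fin r => Measure.pi fun _ : Fin n => gaussianReal 0 1)
    (fun k y => ENNReal.ofReal (Real.exp (∑ l, B k l * y l))) (fun i => by fun_prop)]
  simp_rw [lintegral_exp_sum_mul_pi]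
  rw [← ENNReal.ofReal_prod_of_nonneg fun i _ => (Real.exp_pos _).le, ← Real.exp_sum,
    Finset.sum_div]

instance {r n : ℕ} {v : ℝ≥0} : IsProbabilityMeasure (gaussianMatrixLaw r n v) := by
  unfold gaussianMatrixLaw; infer_instance

theorem one_div_sqrt_le_exp {c : ℝ} (h0 : 0 ≤ c) (h1 : c ≤ 1 / 4) :
    1 / √(1 - 2 * c) ≤ Real.exp (2 * c) := by
  have hp : 0 < 1 - 2 * c := by linarith
  rw [div_le_iff₀ (Real.sqrt_pos.2 hp)]
  have h2 : 1 ≤ Real.exp (2 * c) ^ 2 * (1 - 2 * c) := by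
    rw [← Real.exp_nat_mul]
    have := Real.add_one_le_exp ((2 : ℕ) * (2 * c))
    push_cast at this ⊢
    nlinarith
  calc (1 : ℝ) = √1 := Real.sqrt_one.symm
    _ ≤ √(Real.exp (2 * c) ^ 2 * (1 - 2 * c)) := Real.sqrt_le_sqrt h2
    _ = _ := by rw [Real.sqrt_mul (by positivity), Real.sqrt_sq (by positivity)]

/-- An exponential moment bound for `∑ j, ⟪y, G a_j⟫ ^ 2`, where the `a_j` are orthogonal.
Each factor `exp (c z ^ 2)` is the exponential moment of `√(2c) z` against an independent
standard Gaussian; exchanging the integrals leaves an exponential of a form that is linear in `G`,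
and then a product of exponential moments of squares. -/
theorem lintegral_exp_sum_sq_le {r n : ℕ} {ι : Type*} [Fintype ι]
    (a : ι → EuclideanSpace ℝ (Fin n)) (ha : ∀ i j, i ≠ j → inner ℝ (a i) (a j) = 0)
    (y : EuclideanSpace ℝ (Fin r)) (hy : ‖y‖ ≤ 1) {c : ℝ} (hc : 0 ≤ c)
    (hca : ∀ j, c * ‖a j‖ ^ 2 ≤ 1 / 4) :
    ∫⁻ G, ENNReal.ofReal (Real.exp (c * ∑ j, (∑ k, ∑ l, G k l * (y k * a j l)) ^ 2))
      ∂gaussianMatrixLaw r n 1 ≤ ENNReal.ofReal (Real.exp (2 * c * ∑ j, ‖a j‖ ^ 2)) := by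
  have h1 : ∀ G : Fin r → Fin n → ℝ,
      ENNReal.ofReal (Real.exp (c * ∑ j, (∑ k, ∑ l, G k l * (y k * a j l)) ^ 2)) =
      ∫⁻ h, ENNReal.ofReal (Real.exp
        (∑ j, √(2 * c) * (∑ k, ∑ l, G k l * (y k * a j l)) * h j))
        ∂Measure.pi (fun _ : ι => gaussianReal 0 1) := by
    intro G
    rw [lintegral_exp_sum_mul_pi]
    congr 2
    rw [Finset.mul_sum, Finset.sum_div]
    refine Finset.sum_congr rfl fun j _ => ?_
    rw [mul_pow, Real.sq_sqrt (by positivity)]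
    ring
  have hdist : ∀ h : ι → ℝ, ∑ k, ∑ l, (√(2 * c) * y k * (∑ j, h j * a j l)) ^ 2 ≤
      2 * (c * ∑ j, ‖a j‖ ^ 2 * h j ^ 2) := by
    intro h
    have e1 : ∑ l, (∑ j, h j * a j l) ^ 2 = ∑ j, ‖a j‖ ^ 2 * h j ^ 2 := by
      have e2 : ‖∑ j, h j • a j‖ ^ 2 = ∑ j, ‖a j‖ ^ 2 * h j ^ 2 := by
        rw [← real_inner_self_eq_norm_sq, sum_inner]
        refine Finset.sum_congr rfl fun j _ => ?_
        rw [inner_sum, Finset.sum_eq_single j]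
        · rw [real_inner_smul_left, real_inner_smul_right, real_inner_self_eq_norm_sq]; ring
        · intro i _ hij
          rw [real_inner_smul_left, real_inner_smul_right, ha j i hij.symm]; ring
        · simp
      rw [← e2, EuclideanSpace.real_norm_sq_eq]
      simp
    have e3 : ∑ k, ∑ l, (√(2 * c) * y k * (∑ j, h j * a j l)) ^ 2 =
        2 * c * ‖y‖ ^ 2 * ∑ j, ‖a j‖ ^ 2 * h j ^ 2 := by
      rw [← e1, EuclideanSpace.real_norm_sq_eq, mul_assoc, Finset.sum_mul_sum, Finset.mul_sum]
      refine Finset.sum_congr rfl fun k _ => ?_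
      rw [Finset.mul_sum]
      refine Finset.sum_congr rfl fun l _ => ?_
      rw [mul_pow, mul_pow, Real.sq_sqrt (by positivity)]
      ring
    rw [e3]
    have hnn : 0 ≤ ∑ j, ‖a j‖ ^ 2 * h j ^ 2 := Finset.sum_nonneg fun j _ => by positivity
    have : ‖y‖ ^ 2 ≤ 1 := pow_le_one₀ (norm_nonneg _) hy
    nlinarith [mul_nonneg hc hnn]
  calc _ = ∫⁻ G, ∫⁻ h, ENNReal.ofReal (Real.exp
        (∑ j, √(2 * c) * (∑ k, ∑ l, G k l * (y k * a j l)) * h j))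
        ∂Measure.pi (fun _ : ι => gaussianReal 0 1) ∂gaussianMatrixLaw r n 1 := by simp_rw [h1]
    _ = ∫⁻ h, ∫⁻ G, ENNReal.ofReal (Real.exp
        (∑ j, √(2 * c) * (∑ k, ∑ l, G k l * (y k * a j l)) * h j))
        ∂gaussianMatrixLaw r n 1 ∂Measure.pi (fun _ : ι => gaussianReal 0 1) :=
      lintegral_lintegral_swap (by fun_prop)
    _ = ∫⁻ h, ENNReal.ofReal (Real.exp
          ((∑ k, ∑ l, (√(2 * c) * y k * (∑ j, h j * a j l)) ^ 2) / 2))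
        ∂Measure.pi (fun _ : ι => gaussianReal 0 1) := by
      refine lintegral_congr fun h => ?_
      rw [← lintegral_exp_sum_mul_gaussianMatrixLaw]
      refine lintegral_congr fun G => ?_
      congr 2
      simp_rw [Finset.mul_sum, Finset.sum_mul]
      rw [Finset.sum_comm]
      refine Finset.sum_congr rfl fun k _ => ?_
      rw [Finset.sum_comm]
      refine Finset.sum_congr rfl fun l _ => Finset.sum_congr rfl fun j _ => ?_
      ring
    _ ≤ ∫⁻ h, ∏ j, ENNReal.ofReal (Real.exp (c * ‖a j‖ ^ 2 * h j ^ 2))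
        ∂Measure.pi (fun _ : ι => gaussianReal 0 1) := by
      refine lintegral_mono fun h => ?_
      rw [← ENNReal.ofReal_prod_of_nonneg fun i _ => (Real.exp_pos _).le, ← Real.exp_sum]
      refine ENNReal.ofReal_le_ofReal (Real.exp_le_exp.2 ?_)
      have e : ∑ j, c * ‖a j‖ ^ 2 * h j ^ 2 = c * ∑ j, ‖a j‖ ^ 2 * h j ^ 2 := by
        rw [Finset.mul_sum]
        exact Finset.sum_congr rfl fun j _ => by ring
      rw [e]
      linarith [hdist h]
    _ = ∏ j, ENNReal.ofReal (1 / √(1 - 2 * (c * ‖a j‖ ^ 2))) := by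
      rw [lintegral_pi_prod (fun _ : ι => gaussianReal 0 1)
        (fun j x => ENNReal.ofReal (Real.exp (c * ‖a j‖ ^ 2 * x ^ 2))) fun j => by fun_prop]
      exact Finset.prod_congr rfl fun j _ =>
        lintegral_exp_mul_sq_gaussianReal (by linarith [hca j])
    _ ≤ ∏ j, ENNReal.ofReal (Real.exp (2 * (c * ‖a j‖ ^ 2))) := by
      refine Finset.prod_le_prod' fun j _ => ENNReal.ofReal_le_ofReal ?_
      exact one_div_sqrt_le_exp (by positivity) (hca j)
    _ = _ := by
      rw [← ENNReal.ofReal_prod_of_nonneg fun i _ => (Real.exp_pos _).le, ← Real.exp_sum]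
      congr 2
      rw [Finset.mul_sum]
      exact Finset.sum_congr rfl fun j _ => by ring

/-- The Chernoff bound in the form used below. -/
theorem measure_le_of_lintegral_exp_le {Ω : Type*} [MeasurableSpace Ω] {μ : Measure Ω}
    {f : Ω → ℝ} (hf : Measurable f) {u M : ℝ}
    (h : ∫⁻ ω, ENNReal.ofReal (Real.exp (f ω)) ∂μ ≤ ENNReal.ofReal (Real.exp M)) :
    μ {ω | u ≤ f ω} ≤ ENNReal.ofReal (Real.exp (M - u)) := by
  have h1 := mul_meas_ge_le_lintegral₀ (μ := μ)
    (f := fun ω => ENNReal.ofReal (Real.exp (f ω))) (by fun_prop) (ENNReal.ofReal (Real.exp u))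
  have h2 : {ω | ENNReal.ofReal (Real.exp u) ≤ ENNReal.ofReal (Real.exp (f ω))} =
      {ω | u ≤ f ω} := by
    ext ω
    simp [ENNReal.ofReal_le_ofReal_iff (Real.exp_pos _).le]
  rw [h2] at h1
  have h3 : μ {ω | u ≤ f ω} = ENNReal.ofReal (Real.exp (-u)) *
      (ENNReal.ofReal (Real.exp u) * μ {ω | u ≤ f ω}) := by
    rw [← mul_assoc, ← ENNReal.ofReal_mul (Real.exp_pos _).le, ← Real.exp_add]
    simp
  rw [h3, sub_eq_add_neg, add_comm, Real.exp_add, ENNReal.ofReal_mul (Real.exp_pos _).le]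
  gcongr
  exact h1.trans h

theorem norm_sq_toEuclideanLin {r n : ℕ} (G : Fin r → Fin n → ℝ) (w : EuclideanSpace ℝ (Fin n)) :
    ‖Matrix.toEuclideanLin (Matrix.of G) w‖ ^ 2 = ∑ k, (∑ l, G k l * w l) ^ 2 := by
  rw [EuclideanSpace.real_norm_sq_eq]
  rfl

theorem map_inner_pi_gaussianReal {n : ℕ} (w : EuclideanSpace ℝ (Fin n)) (hw : ‖w‖ = 1) :
    (Measure.pi fun _ : Fin n => gaussianReal 0 1).map (fun g => ∑ l, g l * w l) =
      gaussianReal 0 1 := by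
  have h1 := (isGaussian_stdGaussian (E := EuclideanSpace ℝ (Fin n))).map_eq_gaussianReal
    (innerSL ℝ w)
  rw [integral_strongDual_stdGaussian, variance_dual_stdGaussian, innerSL_apply_norm, hw,
    ← map_pi_eq_stdGaussian, Measure.map_map (by fun_prop) (by fun_prop)] at h1
  convert h1 using 2
  · ext g
    simp [PiLp.inner_apply]
  · simp

theorem lintegral_exp_norm_sq {r n : ℕ} (w : EuclideanSpace ℝ (Fin n)) (hw : ‖w‖ = 1) {c : ℝ}
    (hc : c < 1 / 2) :
    ∫⁻ G, ENNReal.ofReal (Real.exp (c * ∑ k, (∑ l, G k l * w l) ^ 2)) ∂gaussianMatrixLaw r n 1 =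
      ENNReal.ofReal (Real.exp (-(r / 2) * Real.log (1 - 2 * c))) := by
  unfold gaussianMatrixLaw
  simp_rw [Finset.mul_sum, Real.exp_sum,
    ENNReal.ofReal_prod_of_nonneg fun i _ => (Real.exp_pos _).le]
  rw [lintegral_pi_prod (fun _ : Fin r => Measure.pi fun _ : Fin n => gaussianReal 0 1)
    (fun k y => ENNReal.ofReal (Real.exp (c * (∑ l, y l * w l) ^ 2))) (fun i => by fun_prop)]
  have h1 : ∫⁻ y : Fin n → ℝ, ENNReal.ofReal (Real.exp (c * (∑ l, y l * w l) ^ 2))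
      ∂(Measure.pi fun _ : Fin n => gaussianReal 0 1) = ENNReal.ofReal (1 / √(1 - 2 * c)) := by
    conv_rhs => rw [← lintegral_exp_mul_sq_gaussianReal hc, ← map_inner_pi_gaussianReal w hw,
      lintegral_map (by fun_prop) (by fun_prop)]
  rw [h1, Finset.prod_const, Finset.card_univ, Fintype.card_fin,
    ← ENNReal.ofReal_pow (by positivity)]
  congr 1
  have hp : 0 < 1 - 2 * c := by linarith
  rw [one_div, ← Real.sqrt_inv, Real.sqrt_eq_rpow, ← Real.rpow_natCast, ← Real.rpow_mul
    (by positivity), Real.rpow_def_of_pos (by positivity), Real.log_inv]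
  congr 1
  ring

/-- The norm of `G w` is concentrated around its mean square value, for a fixed vector `w`. -/
theorem measure_norm_sq_not_mem_le {r n : ℕ} (w : EuclideanSpace ℝ (Fin n)) :
    gaussianMatrixLaw r n 1 {G | ¬ (r / 2 * ‖w‖ ^ 2 ≤ ‖Matrix.toEuclideanLin (Matrix.of G) w‖ ^ 2 ∧
      ‖Matrix.toEuclideanLin (Matrix.of G) w‖ ^ 2 ≤ 2 * r * ‖w‖ ^ 2)} ≤
      ENNReal.ofReal (2 * Real.exp (-(r / 16))) := by
  rcases eq_or_ne w 0 with rfl | hw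
  · simp
  have hw0 : 0 < ‖w‖ := norm_pos_iff.2 hw
  obtain ⟨u, hu1, hwu⟩ : ∃ u : EuclideanSpace ℝ (Fin n), ‖u‖ = 1 ∧ w = ‖w‖ • u :=
    ⟨‖w‖⁻¹ • w, by rw [norm_smul, norm_inv, norm_norm, inv_mul_cancel₀ hw0.ne'],
      by rw [smul_smul, mul_inv_cancel₀ hw0.ne', one_smul]⟩
  have hl := lintegral_exp_norm_sq (r := r) u hu1 (c := -1 / 2) (by norm_num)
  have hr := lintegral_exp_norm_sq (r := r) u hu1 (c := 1 / 4) (by norm_num)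
  have hl' := measure_le_of_lintegral_exp_le (u := -1 / 2 * (r / 2)) (by fun_prop) hl.le
  have hr' := measure_le_of_lintegral_exp_le (u := 1 / 4 * (2 * r)) (by fun_prop) hr.le
  have hr0 : (0 : ℝ) ≤ r := Nat.cast_nonneg r
  refine (measure_mono (t := {G | -1 / 2 * (r / 2 : ℝ) ≤ -1 / 2 * ∑ k, (∑ l, G k l * u l) ^ 2} ∪
    {G | 1 / 4 * (2 * r : ℝ) ≤ 1 / 4 * ∑ k, (∑ l, G k l * u l) ^ 2}) ?_).trans
    ((measure_union_le _ _).trans ?_)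
  · intro G hG
    have hGw : ‖Matrix.toEuclideanLin (Matrix.of G) w‖ ^ 2 =
        ‖w‖ ^ 2 * ∑ k, (∑ l, G k l * u l) ^ 2 := by
      conv_lhs => rw [hwu]
      rw [map_smul, norm_smul, norm_norm, mul_pow, norm_sq_toEuclideanLin]
    rw [Set.mem_ofPred_eq, hGw, mul_comm (‖w‖ ^ 2), mul_le_mul_iff_left₀ (by positivity),
      mul_le_mul_iff_left₀ (by positivity)] at hG
    by_contra hcon
    simp only [Set.mem_union, Set.mem_ofPred_eq, not_or, not_le] at hcon
    exact hG ⟨by linarith, by linarith⟩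
  · have htwo : ENNReal.ofReal (2 * Real.exp (-(r / 16))) =
        ENNReal.ofReal (Real.exp (-(r / 16))) + ENNReal.ofReal (Real.exp (-(r / 16))) := by
      rw [← ENNReal.ofReal_add (by positivity) (by positivity), ← two_mul]
    rw [htwo]
    have l1 := Real.log_two_gt_d9
    have l2 := Real.log_two_lt_d9
    refine add_le_add (hl'.trans (ENNReal.ofReal_le_ofReal (Real.exp_le_exp.2 ?_)))
      (hr'.trans (ENNReal.ofReal_le_ofReal (Real.exp_le_exp.2 ?_)))
    · norm_num
      nlinarith
    · have : (1 : ℝ) - 2 * (1 / 4) = 2⁻¹ := by norm_num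
      rw [this, Real.log_inv]
      nlinarith

end Gaussian

/-! ### Uniform bounds for Gaussian matrices -/

section Uniform

open Module

theorem measure_biUnion_finset_le_card_mul {Ω α : Type*} [MeasurableSpace Ω] (μ : Measure Ω)
    (N : Finset α) (B : α → Set Ω) {b : ℝ} {m : ℕ} (hm : N.card ≤ m)
    (hB : ∀ y ∈ N, μ (B y) ≤ ENNReal.ofReal b) :
    μ {ω | ∃ y ∈ N, ω ∈ B y} ≤ ENNReal.ofReal (m * b) := by
  have h1 : {ω | ∃ y ∈ N, ω ∈ B y} = ⋃ y ∈ N, B y := by ext ω; simp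
  rw [h1, ENNReal.ofReal_mul (Nat.cast_nonneg m), ENNReal.ofReal_natCast]
  calc μ (⋃ y ∈ N, B y) ≤ ∑ y ∈ N, μ (B y) := measure_biUnion_finset_le _ _
    _ ≤ ∑ _y ∈ N, ENNReal.ofReal b := Finset.sum_le_sum hB
    _ = N.card * ENNReal.ofReal b := by rw [Finset.sum_const, nsmul_eq_mul]
    _ ≤ m * ENNReal.ofReal b := by gcongr

/-- A two-sided norm bound on a `1/8`-net of the unit ball extends to the whole space. -/
theorem norm_map_bounds_of_net {E F : Type*} [NormedAddCommGroup E] [NormedSpace ℝ E]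
    [NormedAddCommGroup F] [NormedSpace ℝ F] (L : E →L[ℝ] F) {N : Finset E} {s : ℝ} (hs : 0 ≤ s)
    (hcov : ∀ x : E, ‖x‖ ≤ 1 → ∃ y ∈ N, ‖x - y‖ ≤ (1 / 2) ^ 3)
    (hN : ∀ y ∈ N, s ^ 2 / 2 * ‖y‖ ^ 2 ≤ ‖L y‖ ^ 2 ∧ ‖L y‖ ^ 2 ≤ 2 * s ^ 2 * ‖y‖ ^ 2) (x : E) :
    s / 4 * ‖x‖ ≤ ‖L x‖ ∧ ‖L x‖ ≤ 2 * s * ‖x‖ := by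
  have hnet : ∀ x : E, ‖x‖ = 1 → ∃ y ∈ N, ‖x - y‖ ≤ 1 / 8 ∧ ‖y‖ ≤ 9 / 8 ∧ 7 / 8 ≤ ‖y‖ := by
    intro x hx
    obtain ⟨y, hy, hxy⟩ := hcov x hx.le
    norm_num at hxy
    refine ⟨y, hy, hxy, ?_, ?_⟩
    · have := norm_sub_norm_le y x
      rw [norm_sub_rev] at this
      linarith
    · have := norm_sub_norm_le x y
      linarith
  -- The constant is a rational bound for `√2 * (9 / 8)`, and `618 / 1000` below is one for
  -- `√(1 / 2) * (7 / 8)`.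
  have hup : ‖L‖ ≤ 1591 / 1000 * s + ‖L‖ * (1 / 8) := by
    refine opNorm_le_of_net L (N := N) (by norm_num) (by positivity) fun x hx => ?_
    obtain ⟨y, hy, hxy, hy1, -⟩ := hnet x hx
    refine ⟨y, hy, hxy, ?_⟩
    refine (sq_le_sq₀ (norm_nonneg _) (by positivity)).1 ((hN y hy).2.trans ?_)
    have h3 : ‖y‖ ^ 2 ≤ (9 / 8) ^ 2 := by gcongr
    nlinarith [sq_nonneg s]
  have hlow : ∀ x : E, ‖x‖ = 1 → s / 4 ≤ ‖L x‖ := by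
    intro x hx
    obtain ⟨y, hy, hxy, -, hy1⟩ := hnet x hx
    have h1 : 618 / 1000 * s ≤ ‖L y‖ := by
      refine (sq_le_sq₀ (by positivity) (norm_nonneg _)).1 (le_trans ?_ (hN y hy).1)
      have h3 : (7 / 8) ^ 2 ≤ ‖y‖ ^ 2 := by gcongr
      nlinarith [sq_nonneg s]
    have h2 : ‖L y‖ ≤ ‖L x‖ + ‖L‖ * (1 / 8) := by
      calc ‖L y‖ = ‖L x - L (x - y)‖ := by rw [map_sub]; congr 1; abel
        _ ≤ ‖L x‖ + ‖L (x - y)‖ := norm_sub_le _ _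
        _ ≤ ‖L x‖ + ‖L‖ * (1 / 8) := by
          gcongr
          exact (L.le_opNorm _).trans (by gcongr)
    linarith
  refine ⟨?_, (L.le_opNorm x).trans (mul_le_mul_of_nonneg_right (by linarith) (norm_nonneg _))⟩
  rcases eq_or_ne x 0 with rfl | hx0
  · simp
  have hxp : 0 < ‖x‖ := norm_pos_iff.2 hx0
  have := hlow (‖x‖⁻¹ • x) (by rw [norm_smul, norm_inv, norm_norm, inv_mul_cancel₀ hxp.ne'])
  rw [map_smul, norm_smul, norm_inv, norm_norm, ← div_eq_inv_mul, le_div_iff₀ hxp] at this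
  exact this

/-- A bound for `∑ j, ⟪y, b_j⟫ ^ 2` on a `1/2`-net of the unit ball controls the operator norm of
`x ↦ ∑ j, x j • b_j`, which is the adjoint of `y ↦ (⟪y, b_j⟫)_j`. -/
theorem norm_sum_smul_sq_le_of_net {F ι : Type*} [NormedAddCommGroup F] [InnerProductSpace ℝ F]
    [FiniteDimensional ℝ F] [Fintype ι] (b : ι → F) {N : Finset F} {s : ℝ} (hs0 : 0 ≤ s)
    (hcov : ∀ x : F, ‖x‖ ≤ 1 → ∃ y ∈ N, ‖x - y‖ ≤ 1 / 2)
    (hN : ∀ y ∈ N, ∑ j, (inner ℝ y (b j)) ^ 2 ≤ s) (x : ι → ℝ) :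
    ‖∑ j, x j • b j‖ ^ 2 ≤ 4 * s * ∑ j, x j ^ 2 := by
  set L : F →L[ℝ] EuclideanSpace ℝ ι :=
    LinearMap.toContinuousLinearMap
      { toFun := fun y => WithLp.toLp 2 fun j => inner ℝ y (b j)
        map_add' := fun y z => by ext j; simp [inner_add_left]
        map_smul' := fun c y => by ext j; simp [inner_smul_left] }
  have hLj : ∀ y j, L y j = inner ℝ y (b j) := fun y j => rfl
  have hLn : ‖L‖ ≤ √s + ‖L‖ * (1 / 2) := by
    refine opNorm_le_of_net L (N := N) (by norm_num) (by positivity) fun x hx => ?_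
    obtain ⟨y, hy, hxy⟩ := hcov x hx.le
    refine ⟨y, hy, hxy, Real.le_sqrt_of_sq_le ?_⟩
    rw [EuclideanSpace.real_norm_sq_eq]
    simp_rw [hLj]
    exact hN y hy
  have hL2 : ‖L‖ ≤ 2 * √s := by linarith
  set Y := ∑ j, x j • b j with hY
  have h1 : ‖Y‖ ^ 2 = ∑ j, x j * L Y j := by
    conv_lhs => rw [← real_inner_self_eq_norm_sq]
    conv_lhs => enter [2]; rw [hY]
    rw [inner_sum]
    refine Finset.sum_congr rfl fun j _ => ?_
    rw [real_inner_smul_right, hLj]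
  have h2 : (∑ j, x j * L Y j) ^ 2 ≤ (∑ j, x j ^ 2) * ‖L Y‖ ^ 2 := by
    rw [EuclideanSpace.real_norm_sq_eq]
    exact Finset.sum_mul_sq_le_sq_mul_sq _ _ _
  have h3 : ‖L Y‖ ^ 2 ≤ 4 * s * ‖Y‖ ^ 2 := by
    have : ‖L Y‖ ≤ 2 * √s * ‖Y‖ :=
      (L.le_opNorm Y).trans (mul_le_mul_of_nonneg_right hL2 (norm_nonneg _))
    calc ‖L Y‖ ^ 2 ≤ (2 * √s * ‖Y‖) ^ 2 := by gcongr
      _ = 4 * s * ‖Y‖ ^ 2 := by rw [mul_pow, mul_pow, Real.sq_sqrt hs0]; ring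
  have hx0 : 0 ≤ ∑ j, x j ^ 2 := Finset.sum_nonneg fun j _ => sq_nonneg _
  have h4 : ‖Y‖ ^ 2 * ‖Y‖ ^ 2 ≤ 4 * s * (∑ j, x j ^ 2) * ‖Y‖ ^ 2 := by
    calc ‖Y‖ ^ 2 * ‖Y‖ ^ 2 = (∑ j, x j * L Y j) ^ 2 := by rw [← h1]; ring
      _ ≤ (∑ j, x j ^ 2) * ‖L Y‖ ^ 2 := h2
      _ ≤ (∑ j, x j ^ 2) * (4 * s * ‖Y‖ ^ 2) := by gcongr
      _ = _ := by ring
  rcases (sq_nonneg ‖Y‖).eq_or_lt with h0 | h0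
  · rw [← h0]; positivity
  · exact le_of_mul_le_mul_right h4 h0

/-- A Gaussian matrix is, up to constant factors, `√r` times an isometry on a fixed subspace of
small dimension. -/
theorem measure_not_subspace_embedding_le {r n t : ℕ}
    (W : Submodule ℝ (EuclideanSpace ℝ (Fin n))) (hW : finrank ℝ W ≤ t) :
    gaussianMatrixLaw r n 1 {G | ¬ ∀ w ∈ W,
      √r / 4 * ‖w‖ ≤ ‖Matrix.toEuclideanLin (Matrix.of G) w‖ ∧
      ‖Matrix.toEuclideanLin (Matrix.of G) w‖ ≤ 2 * √r * ‖w‖} ≤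
      ENNReal.ofReal (((5 ^ t) ^ 3 : ℕ) * (2 * Real.exp (-(r / 16)))) := by
  obtain ⟨N, hN, hcov⟩ := exists_net_of_unit_ball W 3
  have hcard : N.card ≤ (5 ^ t) ^ 3 :=
    hN.trans (Nat.pow_le_pow_left (Nat.pow_le_pow_right (by norm_num) hW) 3)
  have hb := measure_biUnion_finset_le_card_mul (gaussianMatrixLaw r n 1) N
    (fun y => {G | ¬ (r / 2 * ‖(y : EuclideanSpace ℝ (Fin n))‖ ^ 2 ≤
      ‖Matrix.toEuclideanLin (Matrix.of G) y‖ ^ 2 ∧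
      ‖Matrix.toEuclideanLin (Matrix.of G) y‖ ^ 2 ≤
        2 * r * ‖(y : EuclideanSpace ℝ (Fin n))‖ ^ 2)})
    hcard fun y _ => measure_norm_sq_not_mem_le _
  refine (measure_mono fun G hG => ?_).trans hb
  by_contra hcon
  refine hG ?_
  intro w hw
  refine norm_map_bounds_of_net (LinearMap.toContinuousLinearMap
    ((Matrix.toEuclideanLin (Matrix.of G)).domRestrict W)) (Real.sqrt_nonneg _) hcov
    (fun y hy => ?_) ⟨w, hw⟩
  by_contra h
  rw [Real.sq_sqrt (Nat.cast_nonneg r)] at h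
  exact hcon ⟨y, hy, h⟩

theorem inner_toEuclideanLin {r n : ℕ} (G : Fin r → Fin n → ℝ) (y : EuclideanSpace ℝ (Fin r))
    (a : EuclideanSpace ℝ (Fin n)) :
    inner ℝ y (Matrix.toEuclideanLin (Matrix.of G) a) = ∑ k, ∑ l, G k l * (y k * a l) := by
  rw [PiLp.inner_apply]
  refine Finset.sum_congr rfl fun k _ => ?_
  have : (Matrix.toEuclideanLin (Matrix.of G) a) k = ∑ l, G k l * a l := rfl
  rw [this, RCLike.inner_apply, conj_trivial, Finset.sum_mul]
  exact Finset.sum_congr rfl fun l _ => by ring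

/-- An operator norm bound for `x ↦ ∑ j, x j • G a_j`, where the `a_j` are orthogonal: its square
is of the order of `∑ j, ‖a_j‖ ^ 2 + r * max ‖a_j‖ ^ 2`. -/
theorem measure_not_norm_sum_smul_le {r n : ℕ} {ι : Type*} [Fintype ι]
    (a : ι → EuclideanSpace ℝ (Fin n)) (ha : ∀ i j, i ≠ j → inner ℝ (a i) (a j) = 0)
    {S : ℝ} (hS : ∀ j, ‖a j‖ ≤ S) :
    gaussianMatrixLaw r n 1 {G | ¬ ∀ x : ι → ℝ,
      ‖∑ j, x j • Matrix.toEuclideanLin (Matrix.of G) (a j)‖ ^ 2 ≤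
        48 * (∑ j, ‖a j‖ ^ 2 + r * S ^ 2) * ∑ j, x j ^ 2} ≤
      ENNReal.ofReal ((5 ^ r : ℕ) * Real.exp (-(3 * r))) := by
  set T := ∑ j, ‖a j‖ ^ 2 with hT
  have hT0 : 0 ≤ T := Finset.sum_nonneg fun j _ => sq_nonneg _
  have hr0 : (0 : ℝ) ≤ r := Nat.cast_nonneg r
  rcases le_or_gt S 0 with hS0 | hS0
  · have h0 : ∀ j, a j = 0 := fun j => norm_le_zero_iff.1 ((hS j).trans hS0)
    refine (measure_mono (t := ∅) fun G hG => ?_).trans (by simp)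
    refine hG fun x => ?_
    simp only [h0, map_zero, smul_zero, Finset.sum_const_zero, norm_zero]
    have : 0 ≤ ∑ j, x j ^ 2 := Finset.sum_nonneg fun j _ => sq_nonneg _
    rw [zero_pow two_ne_zero]
    positivity
  obtain ⟨N, hN, hN1, hcov⟩ := exists_half_net_of_unit_ball (EuclideanSpace ℝ (Fin r))
  rw [finrank_euclideanSpace_fin] at hN
  -- The exponent `1 / (4 S ^ 2)` is the largest one that `lintegral_exp_sum_sq_le` admits; the
  -- threshold makes the tail `exp (-3 r)`, which beats the cardinality `5 ^ r` of the net.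
  have hfix : ∀ y ∈ N, gaussianMatrixLaw r n 1 {G | 1 / (4 * S ^ 2) * (2 * T + 12 * r * S ^ 2) ≤
      1 / (4 * S ^ 2) * ∑ j, (∑ k, ∑ l, G k l * (y k * a j l)) ^ 2} ≤
      ENNReal.ofReal (Real.exp (-(3 * r))) := by
    intro y hy
    have hle := lintegral_exp_sum_sq_le (r := r) a ha y (hN1 y hy) (c := 1 / (4 * S ^ 2))
      (by positivity) fun j => by
        rw [div_mul_eq_mul_div, one_mul, div_le_div_iff₀ (by positivity) (by norm_num)]
        have : ‖a j‖ ^ 2 ≤ S ^ 2 := by gcongr; exact hS j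
        linarith
    refine (measure_le_of_lintegral_exp_le (by fun_prop) hle).trans
      (ENNReal.ofReal_le_ofReal (Real.exp_le_exp.2 (le_of_eq ?_)))
    rw [← hT]
    field_simp
    ring
  have hb := measure_biUnion_finset_le_card_mul _ N _ hN hfix
  refine (measure_mono fun G hG => ?_).trans hb
  by_contra hcon
  refine hG fun x => ?_
  have h := norm_sum_smul_sq_le_of_net (s := 12 * (T + r * S ^ 2))
    (fun j => Matrix.toEuclideanLin (Matrix.of G) (a j)) (by positivity) hcov
    (fun y hy => ?_) x
  · exact h.trans (le_of_eq (by ring))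
  · simp_rw [inner_toEuclideanLin]
    by_contra! h
    have h' : 2 * T + 12 * r * S ^ 2 ≤ ∑ j, (∑ k, ∑ l, G k l * (y k * a j l)) ^ 2 := by linarith
    have hS' : 0 ≤ 1 / (4 * S ^ 2) := by positivity
    exact hcon ⟨y, hy, mul_le_mul_of_nonneg_left h' hS'⟩

end Uniform

/-! ### Comparison of `ℓ_p` norms -/

section FinsetNorm

open Finset

variable {p q : ℝ} {s : Finset ℕ} {f g : ℕ → ℝ}

theorem finsetNorm_nonneg (hf : ∀ i, 0 ≤ f i) : 0 ≤ finsetNorm p s f :=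
  Real.rpow_nonneg (sum_nonneg fun i _ => Real.rpow_nonneg (hf i) _) _

theorem finsetNorm_rpow (hp : 1 ≤ p) (hf : ∀ i, 0 ≤ f i) :
    finsetNorm p s f ^ p = ∑ i ∈ s, f i ^ p := by
  rw [finsetNorm, ← Real.rpow_mul (sum_nonneg fun i _ => Real.rpow_nonneg (hf i) _),
    one_div_mul_cancel (by linarith), Real.rpow_one]

theorem finsetNorm_le_of_sum_le (hp : 1 ≤ p) (hf : ∀ i, 0 ≤ f i) {b : ℝ} (hb : 0 ≤ b)
    (h : ∑ i ∈ s, f i ^ p ≤ b ^ p) : finsetNorm p s f ≤ b := by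
  rw [← finsetNorm_rpow hp hf] at h
  exact (Real.rpow_le_rpow_iff (finsetNorm_nonneg hf) hb (by linarith)).1 h

theorem le_finsetNorm_of_le_sum (hp : 1 ≤ p) (hf : ∀ i, 0 ≤ f i) {b : ℝ} (hb : 0 ≤ b)
    (h : b ^ p ≤ ∑ i ∈ s, f i ^ p) : b ≤ finsetNorm p s f := by
  rw [← finsetNorm_rpow hp hf] at h
  exact (Real.rpow_le_rpow_iff hb (finsetNorm_nonneg hf) (by linarith)).1 h

theorem finsetNorm_mono (hp : 1 ≤ p) (hf : ∀ i, 0 ≤ f i) {s' : Finset ℕ} (hs : s ⊆ s')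
    (hfg : ∀ i ∈ s, f i ≤ g i) (hg : ∀ i, 0 ≤ g i) : finsetNorm p s f ≤ finsetNorm p s' g := by
  refine finsetNorm_le_of_sum_le hp hf (finsetNorm_nonneg hg) ?_
  rw [finsetNorm_rpow hp hg]
  exact (sum_le_sum fun i hi => Real.rpow_le_rpow (hf i) (hfg i hi) (by linarith)).trans
    (sum_le_sum_of_subset_of_nonneg hs fun i _ _ => Real.rpow_nonneg (hg i) _)

theorem finsetNorm_const (hp : 1 ≤ p) {b : ℝ} (hb : 0 ≤ b) :
    finsetNorm p s (fun _ => b) = (#s : ℝ) ^ (1 / p) * b := by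
  rw [finsetNorm, sum_const, nsmul_eq_mul, Real.mul_rpow (by positivity) (by positivity),
    ← Real.rpow_mul hb, mul_one_div_cancel (by linarith), Real.rpow_one]

theorem finsetNorm_const_mul (hp : 1 ≤ p) (hf : ∀ i, 0 ≤ f i) {b : ℝ} (hb : 0 ≤ b) :
    finsetNorm p s (fun i => b * f i) = b * finsetNorm p s f := by
  unfold finsetNorm
  simp_rw [Real.mul_rpow hb (hf _)]
  rw [← mul_sum, Real.mul_rpow (by positivity)
    (sum_nonneg fun i _ => Real.rpow_nonneg (hf i) _), ← Real.rpow_mul hb,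
    mul_one_div_cancel (by linarith), Real.rpow_one]

theorem finsetNorm_add_le (hp : 1 ≤ p) (hf : ∀ i, 0 ≤ f i) (hg : ∀ i, 0 ≤ g i) :
    finsetNorm p s (fun i => f i + g i) ≤ finsetNorm p s f + finsetNorm p s g := by
  have := Real.Lp_add_le s f g hp
  simpa only [finsetNorm, abs_of_nonneg (hf _), abs_of_nonneg (hg _),
    abs_of_nonneg (add_nonneg (hf _) (hg _))] using this

theorem rpow_card_mul_le_finsetNorm (hp : 1 ≤ p) (hf : ∀ i, 0 ≤ f i) {b : ℝ} (hb : 0 ≤ b)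
    (h : ∀ i ∈ s, b ≤ f i) : (#s : ℝ) ^ (1 / p) * b ≤ finsetNorm p s f := by
  rw [← finsetNorm_const hp hb]
  exact finsetNorm_mono hp (fun _ => hb) Subset.rfl h hf

/-- Interpolation between `ℓ_p` and `ℓ_∞`. -/
theorem finsetNorm_le_rpow_mul_rpow (hp : 1 ≤ p) (hpq : p ≤ q) (hf : ∀ i, 0 ≤ f i) {b : ℝ}
    (hb : 0 ≤ b) (h : ∀ i ∈ s, f i ≤ b) :
    finsetNorm q s f ≤ finsetNorm p s f ^ (p / q) * b ^ (1 - p / q) := by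
  have hq0 : q ≠ 0 := by linarith
  have hn := finsetNorm_nonneg (p := p) (s := s) hf
  refine finsetNorm_le_of_sum_le (hp.trans hpq) hf (by positivity) ?_
  rw [Real.mul_rpow (by positivity) (by positivity), ← Real.rpow_mul hn, ← Real.rpow_mul hb,
    div_mul_cancel₀ _ hq0, sub_mul, div_mul_cancel₀ _ hq0, one_mul, finsetNorm_rpow hp hf, sum_mul]
  refine sum_le_sum fun i hi => ?_
  calc f i ^ q = f i ^ p * f i ^ (q - p) := by
        rw [← Real.rpow_add_of_nonneg (hf i) (by linarith) (by linarith)]; congr 1; ring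
    _ ≤ f i ^ p * b ^ (q - p) := by
        exact mul_le_mul_of_nonneg_left (Real.rpow_le_rpow (hf i) (h i hi) (by linarith))
          (Real.rpow_nonneg (hf i) _)

theorem le_finsetNorm (hp : 1 ≤ p) (hf : ∀ i, 0 ≤ f i) {i : ℕ} (hi : i ∈ s) :
    f i ≤ finsetNorm p s f :=
  le_finsetNorm_of_le_sum hp hf (hf i)
    (single_le_sum (f := fun i => f i ^ p) (fun j _ => Real.rpow_nonneg (hf j) _) hi)

theorem finsetNorm_anti (hp : 1 ≤ p) (hpq : p ≤ q) (hf : ∀ i, 0 ≤ f i) :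
    finsetNorm q s f ≤ finsetNorm p s f := by
  have hn := finsetNorm_nonneg (p := p) (s := s) hf
  refine (finsetNorm_le_rpow_mul_rpow hp hpq hf hn fun i hi => le_finsetNorm hp hf hi).trans ?_
  rw [← Real.rpow_add_of_nonneg hn (div_nonneg (by linarith) (by linarith))
    (sub_nonneg.2 (div_le_one_of_le₀ hpq (by linarith)))]
  simp

/-- The reverse comparison of `ℓ_p` and `ℓ_q`, with a loss depending on the number of terms. -/
theorem finsetNorm_le_rpow_mul (hp : 1 ≤ p) (hpq : p ≤ q) (hf : ∀ i, 0 ≤ f i) {m : ℝ}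
    (hm : (#s : ℝ) ≤ m) : finsetNorm p s f ≤ m ^ (1 / p - 1 / q) * finsetNorm q s f := by
  have hp0 : 0 < p := by linarith
  have hq0 : 0 < q := by linarith
  have hm0 : 0 ≤ m := (Nat.cast_nonneg _).trans hm
  have hn := finsetNorm_nonneg (p := q) (s := s) hf
  have he : 0 ≤ 1 / p - 1 / q := sub_nonneg.2 (one_div_le_one_div_of_le hp0 hpq)
  have h := Real.rpow_sum_le_const_mul_sum_rpow s (fun i => f i ^ p) ((one_le_div hp0).2 hpq)
  simp only [abs_of_nonneg (Real.rpow_nonneg (hf _) _), ← Real.rpow_mul (hf _),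
    mul_div_cancel₀ q hp0.ne'] at h
  rw [← finsetNorm_rpow hp hf, ← finsetNorm_rpow (hp.trans hpq) hf,
    ← Real.rpow_mul (finsetNorm_nonneg hf), mul_div_cancel₀ q hp0.ne'] at h
  refine (Real.rpow_le_rpow_iff (finsetNorm_nonneg hf) (by positivity) hq0).1 (h.trans ?_)
  rw [Real.mul_rpow (by positivity) hn, ← Real.rpow_mul hm0,
    show (1 / p - 1 / q) * q = q / p - 1 by field_simp]
  gcongr
  exact sub_nonneg.2 ((one_le_div hp0).2 hpq)

theorem finsetNorm_union_le (hp : 1 ≤ p) (hf : ∀ i, 0 ≤ f i) {m k : ℕ} (hmk : m ≤ k) :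
    finsetNorm p (range k) f ≤ finsetNorm p (range m) f + finsetNorm p (Ico m k) f := by
  have h1 := finsetNorm_nonneg (p := p) (s := range m) hf
  have h2 := finsetNorm_nonneg (p := p) (s := Ico m k) hf
  refine finsetNorm_le_of_sum_le hp hf (by positivity) ?_
  rw [← sum_range_add_sum_Ico _ hmk, ← finsetNorm_rpow hp hf, ← finsetNorm_rpow hp hf]
  exact Real.add_rpow_le_rpow_add h1 h2 hp

theorem finsetNorm_two (hf : ∀ i, 0 ≤ f i) : finsetNorm 2 s f ^ 2 = ∑ i ∈ s, f i ^ 2 := by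
  have := finsetNorm_rpow (p := 2) (s := s) one_le_two hf
  simpa only [Real.rpow_two] using this

end FinsetNorm

/-! ### The size of a sketch in terms of singular values -/

section SketchSize

open Finset

/-- The typical order of magnitude of the Schatten `q`-norm of `G A`, for a standard Gaussian
matrix `G` with `O(t)` rows, in terms of the singular values `f` of `A`, which has `n` rows: the
first `t` singular values are multiplied by about `√t`, and the others produce about `t`
additional singular values, all of the order of the Frobenius norm of the tail. -/
noncomputable def sketchSize (q : ℝ) (t n : ℕ) (f : ℕ → ℝ) : ℝ :=
  √t * finsetNorm q (range t) f + (t : ℝ) ^ (1 / q) * finsetNorm 2 (Ico t n) f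

variable {p q : ℝ} {t n : ℕ} {f : ℕ → ℝ}

theorem sketchSize_nonneg (hf : ∀ i, 0 ≤ f i) : 0 ≤ sketchSize q t n f :=
  add_nonneg (mul_nonneg (Real.sqrt_nonneg _) (finsetNorm_nonneg hf))
    (mul_nonneg (by positivity) (finsetNorm_nonneg hf))

theorem rpow_mul_le_finsetNorm_range (hq : 1 ≤ q) (hf : ∀ i, 0 ≤ f i) (hanti : Antitone f) :
    (t : ℝ) ^ (1 / q) * f t ≤ finsetNorm q (range t) f := by
  have := rpow_card_mul_le_finsetNorm (s := range t) hq hf (hf t)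
    fun i hi => hanti (mem_range.1 hi).le
  rwa [card_range] at this

theorem sqrt_mul_finsetNorm_le_sketchSize (hf : ∀ i, 0 ≤ f i) :
    √t * finsetNorm q (range t) f ≤ sketchSize q t n f :=
  le_add_of_nonneg_right (mul_nonneg (by positivity) (finsetNorm_nonneg hf))

theorem rpow_mul_finsetNorm_le_sketchSize (hf : ∀ i, 0 ≤ f i) :
    (t : ℝ) ^ (1 / q) * finsetNorm 2 (Ico t n) f ≤ sketchSize q t n f :=
  le_add_of_nonneg_left (mul_nonneg (by positivity) (finsetNorm_nonneg hf))

/-- For `p ≤ 2`, the Frobenius norm of the tail is controlled by the `ℓ_p` norm. -/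
theorem finsetNorm_two_tail_le (hp : 1 ≤ p) (hp2 : p ≤ 2) (ht : 0 < t) (htn : t ≤ n)
    (hf : ∀ i, 0 ≤ f i) (hanti : Antitone f) :
    finsetNorm 2 (Ico t n) f ≤ (t : ℝ) ^ (1 / 2 - 1 / p) * finsetNorm p (range n) f := by
  have ht0 : (0 : ℝ) < t := Nat.cast_pos.2 ht
  have hP := finsetNorm_nonneg (p := p) (s := range n) hf
  have hp0 : 0 < p := by linarith
  have h1 : f t ≤ (t : ℝ) ^ (-(1 / p)) * finsetNorm p (range n) f := by
    have h := (rpow_mul_le_finsetNorm_range hp hf hanti (t := t)).trans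
      (finsetNorm_mono hp hf (range_mono htn) (fun i _ => le_rfl) hf)
    rw [Real.rpow_neg ht0.le, ← div_eq_inv_mul, le_div_iff₀ (by positivity)]
    linarith
  have h2 : finsetNorm p (Ico t n) f ≤ finsetNorm p (range n) f :=
    finsetNorm_mono hp hf (fun i hi => by simp at hi ⊢; omega) (fun i _ => le_rfl) hf
  calc finsetNorm 2 (Ico t n) f
      ≤ finsetNorm p (Ico t n) f ^ (p / 2) * f t ^ (1 - p / 2) :=
        finsetNorm_le_rpow_mul_rpow hp hp2 hf (hf t) fun i hi => hanti (mem_Ico.1 hi).1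
    _ ≤ finsetNorm p (range n) f ^ (p / 2) *
        ((t : ℝ) ^ (-(1 / p)) * finsetNorm p (range n) f) ^ (1 - p / 2) := by
        refine mul_le_mul (Real.rpow_le_rpow (finsetNorm_nonneg hf) h2 (by positivity))
          (Real.rpow_le_rpow (hf t) h1 (by linarith)) (Real.rpow_nonneg (hf t) _) (by positivity)
    _ = (t : ℝ) ^ (1 / 2 - 1 / p) *
        (finsetNorm p (range n) f ^ (p / 2) * finsetNorm p (range n) f ^ (1 - p / 2)) := by
        rw [Real.mul_rpow (by positivity) hP, ← Real.rpow_mul ht0.le,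
          show -(1 / p) * (1 - p / 2) = 1 / 2 - 1 / p by field_simp; ring]
        ring
    _ = _ := by
        rw [← Real.rpow_add_of_nonneg hP (by positivity) (by linarith)]
        simp

/-- For `2 ≤ p`, the `ℓ_p` norm of the tail is controlled by the size of the sketch. -/
theorem finsetNorm_tail_le_sketchSize (hp : 2 ≤ p) (hq : 1 ≤ q) (ht : 0 < t)
    (hf : ∀ i, 0 ≤ f i) (hanti : Antitone f) :
    finsetNorm p (Ico t n) f ≤ (t : ℝ) ^ (1 / p - 1 / q - 1 / 2) * sketchSize q t n f := by
  have ht0 : (0 : ℝ) < t := Nat.cast_pos.2 ht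
  have hN := sketchSize_nonneg (q := q) (t := t) (n := n) hf
  have hp0 : 0 < p := by linarith
  have hq0 : 0 < q := by linarith
  have h1 : f t ≤ (t : ℝ) ^ (-(1 / q) - 1 / 2) * sketchSize q t n f := by
    have h := (mul_le_mul_of_nonneg_left (rpow_mul_le_finsetNorm_range hq hf hanti (t := t))
      (Real.sqrt_nonneg t)).trans (sqrt_mul_finsetNorm_le_sketchSize hf (n := n))
    rw [Real.sqrt_eq_rpow, ← mul_assoc, ← Real.rpow_add ht0] at h
    rw [show -(1 / q) - 1 / 2 = -(1 / 2 + 1 / q) by ring, Real.rpow_neg ht0.le,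
      ← div_eq_inv_mul, le_div_iff₀ (by positivity)]
    linarith
  have h2 : finsetNorm 2 (Ico t n) f ≤ (t : ℝ) ^ (-(1 / q)) * sketchSize q t n f := by
    have h := rpow_mul_finsetNorm_le_sketchSize hf (q := q) (t := t) (n := n)
    rw [Real.rpow_neg ht0.le, ← div_eq_inv_mul, le_div_iff₀ (by positivity)]
    linarith
  have hp1 : 0 ≤ 1 - 2 / p := sub_nonneg.2 ((div_le_one hp0).2 hp)
  calc finsetNorm p (Ico t n) f
      ≤ finsetNorm 2 (Ico t n) f ^ (2 / p) * f t ^ (1 - 2 / p) :=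
        finsetNorm_le_rpow_mul_rpow one_le_two hp hf (hf t) fun i hi => hanti (mem_Ico.1 hi).1
    _ ≤ ((t : ℝ) ^ (-(1 / q)) * sketchSize q t n f) ^ (2 / p) *
        ((t : ℝ) ^ (-(1 / q) - 1 / 2) * sketchSize q t n f) ^ (1 - 2 / p) := by
        refine mul_le_mul (Real.rpow_le_rpow (finsetNorm_nonneg hf) h2 (by positivity))
          (Real.rpow_le_rpow (hf t) h1 hp1) (Real.rpow_nonneg (hf t) _) (by positivity)
    _ = (t : ℝ) ^ (1 / p - 1 / q - 1 / 2) *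
        (sketchSize q t n f ^ (2 / p) * sketchSize q t n f ^ (1 - 2 / p)) := by
        rw [Real.mul_rpow (by positivity) hN, Real.mul_rpow (by positivity) hN,
          ← Real.rpow_mul ht0.le, ← Real.rpow_mul ht0.le,
          show 1 / p - 1 / q - 1 / 2 =
            -(1 / q) * (2 / p) + (-(1 / q) - 1 / 2) * (1 - 2 / p) by field_simp; ring,
          Real.rpow_add ht0]
        ring
    _ = _ := by
        rw [← Real.rpow_add_of_nonneg hN (by positivity) hp1]
        simp

theorem finsetNorm_le_of_head_of_tail (hp : 1 ≤ p) (htn : t ≤ n) (hf : ∀ i, 0 ≤ f i) {a : ℝ}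
    (h1 : finsetNorm p (range t) f ≤ a * (√t * finsetNorm q (range t) f))
    (h2 : finsetNorm p (Ico t n) f ≤ a * ((t : ℝ) ^ (1 / q) * finsetNorm 2 (Ico t n) f)) :
    finsetNorm p (range n) f ≤ a * sketchSize q t n f := by
  rw [sketchSize, mul_add]
  exact (finsetNorm_union_le hp hf htn).trans (add_le_add h1 h2)

theorem eq_rpow_mul_sqrt_mul (ht : 0 < t) (e x : ℝ) :
    (t : ℝ) ^ e * x = (t : ℝ) ^ (e - 1 / 2) * (√t * x) := by
  have ht0 : (0 : ℝ) < t := Nat.cast_pos.2 ht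
  rw [← mul_assoc, Real.sqrt_eq_rpow, ← Real.rpow_add ht0]
  congr 2
  ring

theorem eq_rpow_neg_mul_rpow_mul (ht : 0 < t) (e x : ℝ) :
    x = (t : ℝ) ^ (-e) * ((t : ℝ) ^ e * x) := by
  have ht0 : (0 : ℝ) < t := Nat.cast_pos.2 ht
  rw [← mul_assoc, ← Real.rpow_add ht0]
  simp

theorem finsetNorm_range_head_le (hp : 1 ≤ p) (htn : t ≤ n) (hf : ∀ i, 0 ≤ f i) :
    finsetNorm p (range t) f ≤ finsetNorm p (range n) f :=
  finsetNorm_mono hp hf (range_mono htn) (fun _ _ => le_rfl) hf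

/-- Comparison of the `ℓ_p` norm with `sketchSize` for `p ≤ q ≤ 2`. The first bound is
attained, up to constants, by constant sequences and the second by a single nonzero term. -/
theorem sketchSize_bounds_of_le_of_le_two (hp : 1 ≤ p) (hpq : p ≤ q) (hq2 : q ≤ 2) (ht : 0 < t)
    (htn : t ≤ n) :
    ∃ a b : ℝ, 0 < a ∧ a * b ≤ 4 * ((n : ℝ) ^ (1 / p - 1 / 2) / (t : ℝ) ^ (1 / q - 1 / 2)) ∧
      ∀ f : ℕ → ℝ, (∀ i, 0 ≤ f i) → Antitone f →
        finsetNorm p (range n) f ≤ a * sketchSize q t n f ∧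
        sketchSize q t n f ≤ b * finsetNorm p (range n) f := by
  have ht0 : (0 : ℝ) < t := Nat.cast_pos.2 ht
  have ht1 : (1 : ℝ) ≤ t := Nat.one_le_cast.2 ht
  have hn0 : (0 : ℝ) < n := ht0.trans_le (Nat.cast_le.2 htn)
  have htn' : (t : ℝ) ≤ n := Nat.cast_le.2 htn
  have hp2 : 0 ≤ 1 / p - 1 / 2 :=
    sub_nonneg.2 (one_div_le_one_div_of_le (by linarith) (hpq.trans hq2))
  have hpq' : 1 / q ≤ 1 / p := one_div_le_one_div_of_le (by linarith) hpq
  refine ⟨(n : ℝ) ^ (1 / p - 1 / 2) * (t : ℝ) ^ (-(1 / q)), 2 * √t, by positivity,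
    ?_, fun f hf hanti => ⟨?_, ?_⟩⟩
  · rw [div_eq_mul_inv ((n : ℝ) ^ _), ← Real.rpow_neg ht0.le, Real.sqrt_eq_rpow,
      show -(1 / q - 1 / 2) = -(1 / q) + 1 / 2 by ring, Real.rpow_add ht0]
    have : 0 ≤ (n : ℝ) ^ (1 / p - 1 / 2) * ((t : ℝ) ^ (-(1 / q)) * (t : ℝ) ^ (1 / 2 : ℝ)) := by
      positivity
    linarith
  · refine finsetNorm_le_of_head_of_tail hp htn hf ?_ ?_
    · refine (finsetNorm_le_rpow_mul hp hpq hf (m := t) (by simp)).trans ?_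
      rw [eq_rpow_mul_sqrt_mul ht]
      refine mul_le_mul_of_nonneg_right ?_ (mul_nonneg (by positivity) (finsetNorm_nonneg hf))
      rw [show 1 / p - 1 / q - 1 / 2 = (1 / p - 1 / 2) + -(1 / q) by ring, Real.rpow_add ht0]
      gcongr
    · refine (finsetNorm_le_rpow_mul hp (hpq.trans hq2) hf (m := n) (by simp)).trans ?_
      conv_lhs => rw [eq_rpow_neg_mul_rpow_mul ht (1 / q) (finsetNorm 2 (Ico t n) f)]
      rw [mul_assoc]
  · have h1 := (finsetNorm_anti (s := range t) hp hpq hf).trans (finsetNorm_range_head_le hp htn hf)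
    have h2 := finsetNorm_two_tail_le hp (hpq.trans hq2) ht htn hf hanti
    have hP := finsetNorm_nonneg (p := p) (s := range n) hf
    have h3 : (t : ℝ) ^ (1 / q) * (t : ℝ) ^ (1 / 2 - 1 / p) ≤ √t := by
      rw [← Real.rpow_add ht0, Real.sqrt_eq_rpow]
      exact Real.rpow_le_rpow_of_exponent_le ht1 (by linarith)
    calc sketchSize q t n f ≤ √t * finsetNorm p (range n) f + (t : ℝ) ^ (1 / q) *
          ((t : ℝ) ^ (1 / 2 - 1 / p) * finsetNorm p (range n) f) := by
          unfold sketchSize; gcongr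
      _ ≤ √t * finsetNorm p (range n) f + √t * finsetNorm p (range n) f := by
          rw [← mul_assoc]; gcongr
      _ = _ := by ring

/-- Comparison of the `ℓ_p` norm with `sketchSize` for `q ≤ p ≤ 2`. -/
theorem sketchSize_bounds_of_ge_of_le_two (hq : 1 ≤ q) (hqp : q ≤ p) (hp2 : p ≤ 2) (ht : 0 < t)
    (htn : t ≤ n) :
    ∃ a b : ℝ, 0 < a ∧
      a * b ≤ 4 * max (((n : ℝ) / t) ^ (1 / p - 1 / 2)) ((t : ℝ) ^ (1 / q - 1 / p)) ∧
      ∀ f : ℕ → ℝ, (∀ i, 0 ≤ f i) → Antitone f →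
        finsetNorm p (range n) f ≤ a * sketchSize q t n f ∧
        sketchSize q t n f ≤ b * finsetNorm p (range n) f := by
  have ht0 : (0 : ℝ) < t := Nat.cast_pos.2 ht
  have hn0 : (0 : ℝ) < n := ht0.trans_le (Nat.cast_le.2 htn)
  have hp : 1 ≤ p := hq.trans hqp
  refine ⟨max ((t : ℝ) ^ (-(1 / 2) : ℝ)) ((n : ℝ) ^ (1 / p - 1 / 2) * (t : ℝ) ^ (-(1 / q))),
    2 * (t : ℝ) ^ (1 / q - 1 / p + 1 / 2), by positivity,
    ?_, fun f hf hanti => ⟨?_, ?_⟩⟩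
  · have e1 : (t : ℝ) ^ (-(1 / 2) : ℝ) * (t : ℝ) ^ (1 / q - 1 / p + 1 / 2) =
        (t : ℝ) ^ (1 / q - 1 / p) := by
      rw [← Real.rpow_add ht0]; congr 1; ring
    have e2 : (n : ℝ) ^ (1 / p - 1 / 2) * (t : ℝ) ^ (-(1 / q)) *
        (t : ℝ) ^ (1 / q - 1 / p + 1 / 2) = ((n : ℝ) / t) ^ (1 / p - 1 / 2) := by
      rw [mul_assoc, ← Real.rpow_add ht0, Real.div_rpow hn0.le ht0.le,
        div_eq_mul_inv ((n : ℝ) ^ _),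
        ← Real.rpow_neg ht0.le]
      congr 2; ring
    have e3 : 0 ≤ max (((n : ℝ) / t) ^ (1 / p - 1 / 2)) ((t : ℝ) ^ (1 / q - 1 / p)) := by
      positivity
    rw [mul_left_comm, max_mul_of_nonneg _ _ (by positivity), e1, e2, max_comm]
    linarith
  · refine finsetNorm_le_of_head_of_tail hp htn hf ?_ ?_
    · refine (finsetNorm_anti hq hqp hf).trans ?_
      have := eq_rpow_mul_sqrt_mul ht 0 (finsetNorm q (range t) f)
      rw [Real.rpow_zero, one_mul, zero_sub] at this
      conv_lhs => rw [this]
      exact mul_le_mul_of_nonneg_right (le_max_left _ _)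
        (mul_nonneg (by positivity) (finsetNorm_nonneg hf))
    · refine (finsetNorm_le_rpow_mul hp hp2 hf (m := n) (by simp)).trans ?_
      conv_lhs => rw [eq_rpow_neg_mul_rpow_mul ht (1 / q) (finsetNorm 2 (Ico t n) f)]
      rw [← mul_assoc]
      exact mul_le_mul_of_nonneg_right (le_max_right _ _)
        (mul_nonneg (by positivity) (finsetNorm_nonneg hf))
  · have h1 := finsetNorm_le_rpow_mul (s := range t) hq hqp hf (m := t) (by simp)
    have h1' := finsetNorm_range_head_le hp htn hf
    have h2 := finsetNorm_two_tail_le hp hp2 ht htn hf hanti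
    calc sketchSize q t n f ≤ √t * ((t : ℝ) ^ (1 / q - 1 / p) * finsetNorm p (range n) f) +
          (t : ℝ) ^ (1 / q) * ((t : ℝ) ^ (1 / 2 - 1 / p) * finsetNorm p (range n) f) := by
          unfold sketchSize
          gcongr
          exact h1.trans (by gcongr)
      _ = _ := by
          rw [← mul_assoc, ← mul_assoc, Real.sqrt_eq_rpow, ← Real.rpow_add ht0,
            ← Real.rpow_add ht0, show 1 / 2 + (1 / q - 1 / p) = 1 / q - 1 / p + 1 / 2 by ring,
            show 1 / q + (1 / 2 - 1 / p) = 1 / q - 1 / p + 1 / 2 by ring]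
          ring

theorem sketchSize_le_of_two_le (hp : 2 ≤ p) {a : ℝ} (htn : t ≤ n) (hf : ∀ i, 0 ≤ f i)
    (h : finsetNorm q (range t) f ≤ a * finsetNorm p (range t) f) (ha : 0 ≤ a) :
    sketchSize q t n f ≤
      (√t * a + (t : ℝ) ^ (1 / q) * (n : ℝ) ^ (1 / 2 - 1 / p)) * finsetNorm p (range n) f := by
  have h1 := finsetNorm_le_rpow_mul (s := Ico t n) one_le_two hp hf (m := n) (by simp)
  have h2 : finsetNorm p (Ico t n) f ≤ finsetNorm p (range n) f :=
    finsetNorm_mono (by linarith) hf (fun i hi => by simp at hi ⊢; omega) (fun i _ => le_rfl) hf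
  have h3 := finsetNorm_range_head_le (p := p) (by linarith) htn hf
  rw [add_mul, mul_assoc, mul_assoc]
  unfold sketchSize
  gcongr
  · exact h.trans (by gcongr)
  · exact h1.trans (by gcongr)

/-- Comparison of the `ℓ_p` norm with `sketchSize` for `2 ≤ p ≤ q`. -/
theorem sketchSize_bounds_of_two_le_of_le (hp2 : 2 ≤ p) (hpq : p ≤ q) (ht : 0 < t)
    (htn : t ≤ n) :
    ∃ a b : ℝ, 0 < a ∧
      a * b ≤ 4 * max (((n : ℝ) / t) ^ (1 / 2 - 1 / p)) ((t : ℝ) ^ (1 / p - 1 / q)) ∧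
      ∀ f : ℕ → ℝ, (∀ i, 0 ≤ f i) → Antitone f →
        finsetNorm p (range n) f ≤ a * sketchSize q t n f ∧
        sketchSize q t n f ≤ b * finsetNorm p (range n) f := by
  have ht0 : (0 : ℝ) < t := Nat.cast_pos.2 ht
  have hn0 : (0 : ℝ) < n := ht0.trans_le (Nat.cast_le.2 htn)
  have hp : 1 ≤ p := by linarith
  refine ⟨2 * (t : ℝ) ^ (1 / p - 1 / q - 1 / 2),
    √t * 1 + (t : ℝ) ^ (1 / q) * (n : ℝ) ^ (1 / 2 - 1 / p), by positivity,
    ?_, fun f hf hanti => ⟨?_, ?_⟩⟩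
  · have e1 : (t : ℝ) ^ (1 / p - 1 / q - 1 / 2) * √t = (t : ℝ) ^ (1 / p - 1 / q) := by
      rw [Real.sqrt_eq_rpow, ← Real.rpow_add ht0]; congr 1; ring
    have e2 : (t : ℝ) ^ (1 / p - 1 / q - 1 / 2) *
        ((t : ℝ) ^ (1 / q) * (n : ℝ) ^ (1 / 2 - 1 / p)) = ((n : ℝ) / t) ^ (1 / 2 - 1 / p) := by
      rw [← mul_assoc, ← Real.rpow_add ht0, Real.div_rpow hn0.le ht0.le,
        div_eq_mul_inv ((n : ℝ) ^ _),
        ← Real.rpow_neg ht0.le, mul_comm]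
      congr 2; ring
    rw [mul_one, mul_assoc, mul_add, e1, e2]
    linarith [le_max_left (((n : ℝ) / t) ^ (1 / 2 - 1 / p)) ((t : ℝ) ^ (1 / p - 1 / q)),
      le_max_right (((n : ℝ) / t) ^ (1 / 2 - 1 / p)) ((t : ℝ) ^ (1 / p - 1 / q))]
  · have h1 : finsetNorm p (range t) f ≤
        (t : ℝ) ^ (1 / p - 1 / q - 1 / 2) * sketchSize q t n f := by
      refine (finsetNorm_le_rpow_mul hp hpq hf (m := t) (by simp)).trans ?_
      rw [eq_rpow_mul_sqrt_mul ht]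
      gcongr
      exact sqrt_mul_finsetNorm_le_sketchSize hf
    have h2 := finsetNorm_tail_le_sketchSize (n := n) hp2 (hp.trans hpq) ht hf hanti
    have := finsetNorm_union_le hp hf htn
    linarith
  · refine sketchSize_le_of_two_le hp2 htn hf ?_ zero_le_one
    rw [one_mul]
    exact finsetNorm_anti hp hpq hf

/-- Comparison of the `ℓ_p` norm with `sketchSize` for `2 ≤ q ≤ p`. -/
theorem sketchSize_bounds_of_two_le_of_ge (hq2 : 2 ≤ q) (hqp : q ≤ p) (ht : 0 < t)
    (htn : t ≤ n) :
    ∃ a b : ℝ, 0 < a ∧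
      a * b ≤ 4 * ((n : ℝ) ^ (1 / 2 - 1 / p) / (t : ℝ) ^ (1 / 2 - 1 / q)) ∧
      ∀ f : ℕ → ℝ, (∀ i, 0 ≤ f i) → Antitone f →
        finsetNorm p (range n) f ≤ a * sketchSize q t n f ∧
        sketchSize q t n f ≤ b * finsetNorm p (range n) f := by
  have ht0 : (0 : ℝ) < t := Nat.cast_pos.2 ht
  have ht1 : (1 : ℝ) ≤ t := Nat.one_le_cast.2 ht
  have hn0 : (0 : ℝ) < n := ht0.trans_le (Nat.cast_le.2 htn)
  have htn' : (t : ℝ) ≤ n := Nat.cast_le.2 htn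
  have hq : 1 ≤ q := by linarith
  have hp2 : 0 ≤ 1 / 2 - 1 / p :=
    sub_nonneg.2 (one_div_le_one_div_of_le (by linarith) (hq2.trans hqp))
  have hpq' : 1 / p ≤ 1 / q := one_div_le_one_div_of_le (by linarith) hqp
  refine ⟨2 * (t : ℝ) ^ (-(1 / 2) : ℝ), √t * (t : ℝ) ^ (1 / q - 1 / p) +
    (t : ℝ) ^ (1 / q) * (n : ℝ) ^ (1 / 2 - 1 / p), by positivity,
    ?_, fun f hf hanti => ⟨?_, ?_⟩⟩
  · have e1 : √t * (t : ℝ) ^ (1 / q - 1 / p) ≤ (t : ℝ) ^ (1 / q) * (n : ℝ) ^ (1 / 2 - 1 / p) := by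
      calc √t * (t : ℝ) ^ (1 / q - 1 / p) = (t : ℝ) ^ (1 / q) * (t : ℝ) ^ (1 / 2 - 1 / p) := by
            rw [Real.sqrt_eq_rpow, ← Real.rpow_add ht0, ← Real.rpow_add ht0]; congr 1; ring
        _ ≤ _ := by gcongr
    have e2 : (t : ℝ) ^ (-(1 / 2) : ℝ) * ((t : ℝ) ^ (1 / q) * (n : ℝ) ^ (1 / 2 - 1 / p)) =
        (n : ℝ) ^ (1 / 2 - 1 / p) / (t : ℝ) ^ (1 / 2 - 1 / q) := by
      rw [← mul_assoc, ← Real.rpow_add ht0, div_eq_mul_inv ((n : ℝ) ^ _), ← Real.rpow_neg ht0.le,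
        mul_comm]
      congr 2; ring
    have e3 : 0 ≤ (t : ℝ) ^ (-(1 / 2) : ℝ) := by positivity
    rw [← e2]
    nlinarith
  · have h1 : finsetNorm p (range t) f ≤ (t : ℝ) ^ (-(1 / 2) : ℝ) * sketchSize q t n f := by
      refine (finsetNorm_anti hq hqp hf).trans ?_
      have := eq_rpow_mul_sqrt_mul ht 0 (finsetNorm q (range t) f)
      rw [Real.rpow_zero, one_mul, zero_sub] at this
      rw [this]
      gcongr
      exact sqrt_mul_finsetNorm_le_sketchSize hf
    have h2 : finsetNorm p (Ico t n) f ≤ (t : ℝ) ^ (-(1 / 2) : ℝ) * sketchSize q t n f := by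
      refine (finsetNorm_tail_le_sketchSize (n := n) (hq2.trans hqp) hq ht hf hanti).trans ?_
      have := sketchSize_nonneg (q := q) (t := t) (n := n) hf
      exact mul_le_mul_of_nonneg_right
        (Real.rpow_le_rpow_of_exponent_le ht1 (by linarith)) this
    have := finsetNorm_union_le (hq.trans hqp) hf htn
    linarith
  · exact sketchSize_le_of_two_le (hq2.trans hqp) htn hf
      (finsetNorm_le_rpow_mul hq hqp hf (by simp)) (by positivity)

end SketchSize

/-! ### Singular values of a composition -/

section Composition

open Module InnerProductSpace

variable {E : Type*} [NormedAddCommGroup E] [InnerProductSpace ℝ E] [FiniteDimensional ℝ E]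
  {F : Type*} [NormedAddCommGroup F] [InnerProductSpace ℝ F] [FiniteDimensional ℝ F]
  {H : Type*} [NormedAddCommGroup H] [InnerProductSpace ℝ H] [FiniteDimensional ℝ H]
  {d t : ℕ} (S : E →ₗ[ℝ] F) (G : F →ₗ[ℝ] H) (hd : finrank ℝ E = d) {ρ R : ℝ}

theorem singularValues_comp_le_add (hρ : 0 ≤ ρ) (hR : 0 ≤ R)
    (h1 : ∀ x ∈ coordSpan (rightSingularBasis S hd) {j | (j : ℕ) < t}, ‖G (S x)‖ ≤ ρ * ‖S x‖)
    (h2 : ∀ x ∈ coordSpan (rightSingularBasis S hd) {j | t ≤ (j : ℕ)}, ‖G (S x)‖ ≤ R * ‖x‖)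
    (i : ℕ) : (G ∘ₗ S).singularValues i ≤ ρ * S.singularValues i + R := by
  have hσ := S.singularValues_nonneg i
  refine singularValues_le_of_forall_norm_le _
    (coordSpan (rightSingularBasis S hd) {j | i ≤ (j : ℕ)}) (by positivity) ?_ fun x hx => ?_
  · rw [finrank_coordSpan_ge]; omega
  obtain ⟨y, z, hxyz, hy, hz, hyx, hzx⟩ :=
    exists_add_of_coordSpan (rightSingularBasis S hd) {j | (j : ℕ) < t} _ hx
  have hz' : z ∈ coordSpan (rightSingularBasis S hd) {j | t ≤ (j : ℕ)} :=
    coordSpan_mono _ (fun j hj => by simpa using hj) hz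
  have h3 : ‖G (S y)‖ ≤ ρ * S.singularValues i * ‖x‖ := by
    calc ‖G (S y)‖ ≤ ρ * ‖S y‖ := h1 y (coordSpan_mono _ Set.inter_subset_left hy)
      _ ≤ ρ * (S.singularValues i * ‖y‖) := by
        gcongr
        exact norm_map_le_of_mem_coordSpan S hd i (coordSpan_mono _ Set.inter_subset_right hy)
      _ ≤ ρ * (S.singularValues i * ‖x‖) := by gcongr
      _ = _ := by ring
  calc ‖(G ∘ₗ S) x‖ = ‖G (S y) + G (S z)‖ := by rw [LinearMap.comp_apply, hxyz, map_add, map_add]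
    _ ≤ ‖G (S y)‖ + ‖G (S z)‖ := norm_add_le _ _
    _ ≤ ρ * S.singularValues i * ‖x‖ + R * ‖x‖ :=
      add_le_add h3 ((h2 z hz').trans (by gcongr))
    _ = _ := by ring

theorem singularValues_comp_le_of_le (hR : 0 ≤ R)
    (h2 : ∀ x ∈ coordSpan (rightSingularBasis S hd) {j | t ≤ (j : ℕ)}, ‖G (S x)‖ ≤ R * ‖x‖)
    {i : ℕ} (hi : t ≤ i) : (G ∘ₗ S).singularValues i ≤ R :=
  singularValues_le_of_forall_norm_le _
    (coordSpan (rightSingularBasis S hd) {j | t ≤ (j : ℕ)}) hR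
    (by rw [finrank_coordSpan_ge]; omega) h2

theorem mul_singularValues_le_singularValues_comp (hρ : 0 ≤ ρ)
    (h1 : ∀ x ∈ coordSpan (rightSingularBasis S hd) {j | (j : ℕ) < t}, ρ * ‖S x‖ ≤ ‖G (S x)‖)
    {i : ℕ} (hi : i < t) : ρ * S.singularValues i ≤ (G ∘ₗ S).singularValues i := by
  rcases le_or_gt d i with hid | hid
  · rw [S.singularValues_of_finrank_le (hd.trans_le hid), mul_zero]
    exact LinearMap.singularValues_nonneg _ i
  refine le_singularValues_of_forall_le_norm _
    (coordSpan (rightSingularBasis S hd) {j | (j : ℕ) < i + 1}) ?_ fun x hx => ?_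
  · rw [finrank_coordSpan_lt]; omega
  calc ρ * S.singularValues i * ‖x‖ = ρ * (S.singularValues i * ‖x‖) := by ring
    _ ≤ ρ * ‖S x‖ := by
      gcongr
      exact le_norm_map_of_mem_coordSpan S hd i (by simpa [Nat.lt_succ_iff] using hx)
    _ ≤ ‖(G ∘ₗ S) x‖ := h1 x (coordSpan_mono _ (fun j hj => by
      simp only [Set.mem_ofPred_eq] at hj ⊢; omega) hx)

/-- The singular values of the restriction of a composition `G ∘ S` to the span of the right
singular vectors of `S` of index at least `t`: they are bounded by those of `G ∘ S`, and the sum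
of their squares is explicit. -/
theorem exists_le_singularValues_comp_tail (hR : 0 ≤ R)
    (h2 : ∀ x ∈ coordSpan (rightSingularBasis S hd) {j | t ≤ (j : ℕ)}, ‖G (S x)‖ ≤ R * ‖x‖)
    {m : ℕ} (hm : finrank ℝ H ≤ m) :
    ∃ s : ℕ → ℝ, (∀ i, 0 ≤ s i) ∧ (∀ i, s i ≤ R) ∧ (∀ i, s i ≤ (G ∘ₗ S).singularValues i) ∧
      ∑ i ∈ Finset.range m, s i ^ 2 =
        ∑ j : {j : Fin d // t ≤ (j : ℕ)}, ‖G (S (rightSingularBasis S hd j))‖ ^ 2 := by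
  set v := rightSingularBasis S hd
  have hli : LinearIndependent ℝ fun j : {j : Fin d // t ≤ (j : ℕ)} => v j :=
    v.orthonormal.linearIndependent.comp _ Subtype.val_injective
  have hb : ∀ j, ((Basis.span hli j : Submodule.span ℝ (Set.range fun j :
      {j : Fin d // t ≤ (j : ℕ)} => v j)) : E) = v j :=
    fun j => congrArg Subtype.val (Basis.span_apply hli j)
  have hon : Orthonormal ℝ (Basis.span hli) := by
    have h := v.orthonormal.comp (fun j : {j : Fin d // t ≤ (j : ℕ)} => (j : Fin d))
      Subtype.val_injective
    refine ⟨fun j => ?_, fun i j hij => ?_⟩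
    · rw [Submodule.coe_norm, hb]; exact h.1 j
    · change ⟪Basis.span hli i, Basis.span hli j⟫_ℝ = 0
      rw [Submodule.coe_inner, hb, hb]; exact h.2 hij
  set M := (G ∘ₗ S).domRestrict (Submodule.span ℝ (Set.range fun j :
      {j : Fin d // t ≤ (j : ℕ)} => v j))
  refine ⟨M.singularValues, M.singularValues_nonneg, fun i => ?_,
    fun i => singularValues_domRestrict_le _ _ i, ?_⟩
  · exact singularValues_le_of_forall_norm_le M ⊤ hR (by simp) fun x _ => h2 x x.2
  · rw [sum_sq_singularValues M ((Basis.span hli).toOrthonormalBasis hon)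
      ((Submodule.finrank_le _).trans hm)]
    refine Finset.sum_congr rfl fun j _ => ?_
    rw [Basis.coe_toOrthonormalBasis, LinearMap.domRestrict_apply, hb]
    rfl

end Composition

/-! ### From singular values to Schatten norms -/

section Sequences

open Finset

variable {q : ℝ} {t n : ℕ} {f s s' : ℕ → ℝ} {R : ℝ}

theorem rpow_one_div_le_self {x : ℝ} (hx : 1 ≤ x) (hq : 1 ≤ q) : x ^ (1 / q) ≤ x := by
  have := Real.rpow_le_rpow_of_exponent_le hx ((div_le_one (by linarith)).2 hq)
  rwa [Real.rpow_one] at this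

theorem finsetNorm_le_sketchSize (hq : 1 ≤ q) (hf : ∀ i, 0 ≤ f i) (hanti : Antitone f)
    (hs : ∀ i, 0 ≤ s i) (hR0 : 0 ≤ R) (hR : R ≤ 7 * (finsetNorm 2 (Ico t n) f + 16 * (√t * f t)))
    (h1 : ∀ i, s i ≤ 32 * √t * f i + R) (h2 : ∀ i, t ≤ i → s i ≤ R) :
    finsetNorm q (range (256 * t)) s ≤ 30000 * sketchSize q t n f := by
  have hg0 : ∀ i, 0 ≤ if i < t then 32 * √t * f i else 0 := fun i => by
    split_ifs
    · exact mul_nonneg (by positivity) (hf i)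
    · exact le_rfl
  have hS := finsetNorm_nonneg (p := q) (s := range t) hf
  have hT := finsetNorm_nonneg (p := 2) (s := Ico t n) hf
  have hhead : finsetNorm q (range (256 * t)) (fun i => if i < t then 32 * √t * f i else 0) ≤
      32 * √t * finsetNorm q (range t) f := by
    rw [← finsetNorm_const_mul hq hf (by positivity)]
    refine finsetNorm_le_of_sum_le hq hg0
      (finsetNorm_nonneg fun i => mul_nonneg (by positivity) (hf i)) ?_
    rw [finsetNorm_rpow hq fun i => mul_nonneg (by positivity) (hf i)]
    rw [← sum_subset (range_mono (show t ≤ 256 * t by omega)) fun i _ hi => by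
      rw [if_neg (by simpa using hi), Real.zero_rpow (by linarith)]]
    exact le_of_eq (sum_congr rfl fun i hi => by rw [if_pos (mem_range.1 hi)])
  have hcard : ((#(range (256 * t)) : ℕ) : ℝ) ^ (1 / q) ≤ 256 * (t : ℝ) ^ (1 / q) := by
    rw [card_range]
    push_cast
    rw [Real.mul_rpow (by norm_num) (by positivity)]
    gcongr
    exact rpow_one_div_le_self (by norm_num) hq
  have h3 : finsetNorm q (range (256 * t)) s ≤
      32 * √t * finsetNorm q (range t) f + 256 * (t : ℝ) ^ (1 / q) * R := by
    calc finsetNorm q (range (256 * t)) s ≤ finsetNorm q (range (256 * t))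
          (fun i => (if i < t then 32 * √t * f i else 0) + R) := by
          refine finsetNorm_mono hq hs Subset.rfl (fun i _ => ?_)
            fun i => add_nonneg (hg0 i) hR0
          split_ifs with h
          · exact h1 i
          · rw [zero_add]; exact h2 i (not_lt.1 h)
      _ ≤ _ := finsetNorm_add_le hq hg0 fun _ => hR0
      _ ≤ _ := by
          rw [finsetNorm_const hq hR0]
          gcongr
  have h4 : √t * ((t : ℝ) ^ (1 / q) * f t) ≤ √t * finsetNorm q (range t) f := by
    gcongr
    exact rpow_mul_le_finsetNorm_range hq hf hanti
  have h5 : (t : ℝ) ^ (1 / q) * R ≤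
      7 * ((t : ℝ) ^ (1 / q) * finsetNorm 2 (Ico t n) f + 16 * (√t * ((t : ℝ) ^ (1 / q) * f t))) :=
    (mul_le_mul_of_nonneg_left hR (by positivity)).trans (le_of_eq (by ring))
  have h6 : 0 ≤ √t * finsetNorm q (range t) f := by positivity
  have h7 : 0 ≤ (t : ℝ) ^ (1 / q) * finsetNorm 2 (Ico t n) f := by positivity
  unfold sketchSize
  linarith

/-- The lower bound for the Schatten norm of a sketch. If the tail is not negligible, it provides
a number of singular values of order `t` of the order of its Frobenius norm, by the pigeonhole
principle. -/
theorem sketchSize_le_finsetNorm (hq : 1 ≤ q) (hf : ∀ i, 0 ≤ f i) (hanti : Antitone f)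
    (hs : ∀ i, 0 ≤ s i) (hR : R ≤ 7 * (finsetNorm 2 (Ico t n) f + 16 * (√t * f t)))
    (h1 : ∀ i, i < t → 4 * √t * f i ≤ s i) (hs' : ∀ i, 0 ≤ s' i) (hs'R : ∀ i, s' i ≤ R)
    (hs's : ∀ i, s' i ≤ s i)
    (h2 : 128 * t * finsetNorm 2 (Ico t n) f ^ 2 ≤ ∑ i ∈ range (256 * t), s' i ^ 2) :
    sketchSize q t n f ≤ 500 * finsetNorm q (range (256 * t)) s := by
  have hT := finsetNorm_nonneg (p := 2) (s := Ico t n) hf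
  have hX := finsetNorm_nonneg (p := q) (s := range (256 * t)) hs
  have hhead : 4 * √t * finsetNorm q (range t) f ≤ finsetNorm q (range (256 * t)) s := by
    rw [← finsetNorm_const_mul hq hf (by positivity)]
    exact finsetNorm_mono hq (fun i => mul_nonneg (by positivity) (hf i))
      (range_mono (by omega)) (fun i hi => h1 i (mem_range.1 hi)) hs
  set T := finsetNorm 2 (Ico t n) f with hTdef
  rcases le_or_gt T (√t * f t) with hcase | hcase
  · have h3 : (t : ℝ) ^ (1 / q) * T ≤ √t * finsetNorm q (range t) f := by
      calc (t : ℝ) ^ (1 / q) * T ≤ (t : ℝ) ^ (1 / q) * (√t * f t) := by gcongr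
        _ = √t * ((t : ℝ) ^ (1 / q) * f t) := by ring
        _ ≤ _ := by
          gcongr
          exact rpow_mul_le_finsetNorm_range hq hf hanti
    unfold sketchSize
    rw [← hTdef]
    linarith
  · have hT0 : 0 < T := (mul_nonneg (Real.sqrt_nonneg _) (hf t)).trans_lt hcase
    have hR' : R ≤ 119 * T := by linarith
    set J := (range (256 * t)).filter fun i => T / 2 ≤ s' i with hJ
    have h3 : ∑ i ∈ range (256 * t), s' i ^ 2 ≤ #J * (119 * T) ^ 2 + 256 * t * (T / 2) ^ 2 := by
      rw [← sum_filter_add_sum_filter_not (range (256 * t)) fun i => T / 2 ≤ s' i]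
      refine add_le_add ?_ ?_
      · rw [← nsmul_eq_mul]
        exact sum_le_card_nsmul _ _ _ fun i _ =>
          pow_le_pow_left₀ (hs' i) ((hs'R i).trans hR') 2
      · have h4 : ∑ i ∈ range (256 * t) with ¬T / 2 ≤ s' i, s' i ^ 2 ≤
            #{i ∈ range (256 * t) | ¬T / 2 ≤ s' i} • (T / 2) ^ 2 :=
          sum_le_card_nsmul _ _ _ fun i hi =>
            pow_le_pow_left₀ (hs' i) (not_le.1 (mem_filter.1 hi).2).le 2
        refine h4.trans ?_
        rw [nsmul_eq_mul]
        gcongr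
        have := card_filter_le (range (256 * t)) fun i => ¬T / 2 ≤ s' i
        rw [card_range] at this
        exact_mod_cast this
    have h4 : (t : ℝ) ≤ 222 * #J := by
      have h5 : (64 * t : ℝ) * T ^ 2 ≤ (14161 * #J) * T ^ 2 := by nlinarith
      have h6 := le_of_mul_le_mul_right h5 (by positivity)
      have : (0 : ℝ) ≤ #J := Nat.cast_nonneg _
      linarith
    have h5 : (t : ℝ) ^ (1 / q) * T ≤ 444 * finsetNorm q (range (256 * t)) s := by
      have h6 : (#J : ℝ) ^ (1 / q) * (T / 2) ≤ finsetNorm q (range (256 * t)) s :=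
        (rpow_card_mul_le_finsetNorm hq hs (by positivity)
          fun i hi => (mem_filter.1 hi).2.trans (hs's i)).trans
          (finsetNorm_mono hq hs (filter_subset _ _) (fun _ _ => le_rfl) hs)
      calc (t : ℝ) ^ (1 / q) * T ≤ (222 * #J : ℝ) ^ (1 / q) * T := by gcongr
        _ = (222 : ℝ) ^ (1 / q) * ((#J : ℝ) ^ (1 / q) * T) := by
          rw [Real.mul_rpow (by norm_num) (by positivity), mul_assoc]
        _ ≤ 222 * ((#J : ℝ) ^ (1 / q) * T) := by
          gcongr
          exact rpow_one_div_le_self (by norm_num) hq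
        _ ≤ _ := by linarith
    unfold sketchSize
    rw [← hTdef]
    linarith

end Sequences

/-! ### Schatten norms of Gaussian sketches -/

section Sketch

open Finset

/-- The union bound for the three exceptional events. With `256 t` rows the Gaussian tails beat the
cardinalities `5 ^ (3 t)` and `5 ^ (256 t)` of the nets, and also the factor `n ≤ exp t`. -/
theorem failure_probability_le {n t : ℕ} (ht : 0 < t) (hnt : Real.log n ≤ t) (hn : 0 < n) :
    ((5 ^ t) ^ 3 : ℕ) * (2 * Real.exp (-((256 * t : ℕ) / 16))) +
      (5 ^ (256 * t) : ℕ) * Real.exp (-(3 * (256 * t : ℕ))) +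
      n * (2 * Real.exp (-((256 * t : ℕ) / 16))) ≤ Real.exp (-t) := by
  have h5 : (5 : ℝ) ≤ Real.exp 2 := by
    have h := Real.exp_one_gt_d9
    have : Real.exp 2 = Real.exp 1 ^ 2 := by rw [← Real.exp_nat_mul]; norm_num
    rw [this]; nlinarith
  have ht1 : (1 : ℝ) ≤ t := Nat.one_le_cast.2 ht
  have h5k : ∀ k : ℕ, (5 : ℝ) ^ k ≤ Real.exp (2 * k) := fun k => by
    rw [mul_comm, Real.exp_nat_mul]; gcongr
  have hn' : (n : ℝ) ≤ Real.exp t := (Real.log_le_iff_le_exp (Nat.cast_pos.2 hn)).1 hnt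
  have a1 : ((5 ^ t) ^ 3 : ℕ) * (2 * Real.exp (-((256 * t : ℕ) / 16))) ≤
      2 * Real.exp (-10 * t) := by
    have : (((5 ^ t) ^ 3 : ℕ) : ℝ) ≤ Real.exp (6 * t) := by
      have := h5k (t * 3)
      push_cast at this ⊢
      rw [← pow_mul]
      exact this.trans (le_of_eq (by congr 1; ring))
    calc _ ≤ Real.exp (6 * t) * (2 * Real.exp (-((256 * t : ℕ) / 16))) := by gcongr
      _ = 2 * (Real.exp (6 * t) * Real.exp (-((256 * t : ℕ) / 16))) := by ring
      _ = _ := by rw [← Real.exp_add]; push_cast; congr 2; ring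
  have a2 : (5 ^ (256 * t) : ℕ) * Real.exp (-(3 * (256 * t : ℕ))) ≤ Real.exp (-10 * t) := by
    calc _ ≤ Real.exp (2 * (256 * t : ℕ)) * Real.exp (-(3 * (256 * t : ℕ))) := by
          gcongr
          have := h5k (256 * t)
          push_cast at this ⊢
          exact this
      _ ≤ _ := by rw [← Real.exp_add, Real.exp_le_exp]; push_cast; linarith
  have a3 : n * (2 * Real.exp (-((256 * t : ℕ) / 16))) ≤ 2 * Real.exp (-10 * t) := by
    calc _ ≤ Real.exp t * (2 * Real.exp (-((256 * t : ℕ) / 16))) := by gcongr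
      _ = 2 * (Real.exp t * Real.exp (-((256 * t : ℕ) / 16))) := by ring
      _ ≤ _ := by
        rw [← Real.exp_add]
        gcongr
        push_cast
        linarith
  have a4 : 5 * Real.exp (-10 * t) ≤ Real.exp (-t) := by
    calc 5 * Real.exp (-10 * t) ≤ Real.exp 2 * Real.exp (-10 * t) := by gcongr
      _ ≤ _ := by rw [← Real.exp_add, Real.exp_le_exp]; linarith
  linarith

theorem sum_subtype_of_eq_zero {α M : Type*} [Fintype α] [AddCommMonoid M] {P : α → Prop}
    [DecidablePred P] {g : α → M} (h : ∀ j, ¬ P j → g j = 0) :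
    ∑ j : {j // P j}, g j = ∑ j, g j := by
  rw [← sum_subtype (univ.filter P) (by simp) g]
  exact sum_subset (subset_univ _) fun j _ hj => h j (by simpa using hj)

theorem sum_Ico_eq_of_eq_zero {f : ℕ → ℝ} {t n d : ℕ} (hn : ∀ i, n ≤ i → f i = 0)
    (hd : ∀ i, d ≤ i → f i = 0) : ∑ i ∈ Ico t n, f i = ∑ i ∈ Ico t d, f i := by
  have h : ∀ k, min n d ≤ k → ∑ i ∈ Ico t (min n d), f i = ∑ i ∈ Ico t k, f i := fun k hk =>
    sum_subset (Ico_subset_Ico_right hk) fun i hi hi' => by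
      simp only [mem_Ico] at hi hi'
      rcases le_or_gt n i with h | h
      · exact hn i h
      · exact hd i (by omega)
  rw [← h n (min_le_left _ _), ← h d (min_le_right _ _)]

/-- With overwhelming probability, the Schatten `q`-norm of a Gaussian sketch `G A` is comparable,
for all `q ≥ 1` simultaneously, to a function of the singular values of `A`. -/
theorem measure_not_schattenNorm_comparable_le {n t d : ℕ} (ht : 0 < t) (htn : t ≤ n)
    (hnt : Real.log n ≤ t) (A : Matrix (Fin n) (Fin d) ℝ) :
    gaussianMatrixLaw (256 * t) n 1 {G | ¬ ∀ q : ℝ, 1 ≤ q →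
      sketchSize q t n (Matrix.toEuclideanLin A).singularValues ≤
        500 * schattenNorm q (Matrix.of G * A) ∧
      schattenNorm q (Matrix.of G * A) ≤
        30000 * sketchSize q t n (Matrix.toEuclideanLin A).singularValues} ≤
      ENNReal.ofReal (Real.exp (-t)) := by
  set S := Matrix.toEuclideanLin A with hS
  have hd : Module.finrank ℝ (EuclideanSpace ℝ (Fin d)) = d := finrank_euclideanSpace_fin
  set v := rightSingularBasis S hd with hv
  set f : ℕ → ℝ := fun i => S.singularValues i with hfdef
  have hf : ∀ i, 0 ≤ f i := S.singularValues_nonneg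
  have hanti : Antitone f := S.singularValues_antitone
  have hfn : ∀ i, n ≤ i → f i = 0 := fun i hi =>
    (S.singularValues_eq_zero_iff_le_finrank_range).2 (by
      rw [hS, finrank_range_toEuclideanLin]; exact (Matrix.rank_le_height A).trans hi)
  have hfd : ∀ i, d ≤ i → f i = 0 := fun i hi =>
    S.singularValues_of_finrank_le (hd.trans_le hi)
  have hav : ∀ j, ‖S (v j)‖ = f j := norm_map_rightSingularBasis S hd
  set T := finsetNorm 2 (Ico t n) f with hT
  have hT0 : 0 ≤ T := finsetNorm_nonneg hf
  have hTsq : ∑ j : {j : Fin d // t ≤ (j : ℕ)}, ‖S (v j)‖ ^ 2 = T ^ 2 := by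
    rw [hT, finsetNorm_two hf, sum_Ico_eq_of_eq_zero (f := fun i => f i ^ 2) (d := d)
      (fun i hi => by simp [hfn i hi]) (fun i hi => by simp [hfd i hi])]
    simp_rw [hav]
    refine sum_nbij (fun j => ((j : Fin d) : ℕ)) (fun j _ => mem_Ico.2 ⟨j.2, j.1.2⟩)
      (fun i _ j _ hij => Subtype.ext (Fin.ext hij)) (fun i hi => ?_) fun j _ => rfl
    rw [mem_coe, mem_Ico] at hi
    exact ⟨⟨⟨i, hi.2⟩, hi.1⟩, mem_coe.2 (mem_univ _), rfl⟩
  -- Off `B₁`, the matrix `G` nearly preserves norms on the span of the top `t` left singular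
  -- vectors; off `B₂`, the operator norm of `G A` on the tail is bounded; off `B₃`, the image of
  -- each singular vector is not too short, which bounds the Frobenius norm of the tail from below.
  set B₁ := {G : Fin (256 * t) → Fin n → ℝ | ¬ ∀ w ∈ (coordSpan v {j | (j : ℕ) < t}).map S,
      √(256 * t : ℕ) / 4 * ‖w‖ ≤ ‖Matrix.toEuclideanLin (Matrix.of G) w‖ ∧
      ‖Matrix.toEuclideanLin (Matrix.of G) w‖ ≤ 2 * √(256 * t : ℕ) * ‖w‖} with hB₁
  set B₂ := {G : Fin (256 * t) → Fin n → ℝ | ¬ ∀ x : {j : Fin d // t ≤ (j : ℕ)} → ℝ,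
      ‖∑ j, x j • Matrix.toEuclideanLin (Matrix.of G) (S (v j))‖ ^ 2 ≤
        48 * (∑ j : {j : Fin d // t ≤ (j : ℕ)}, ‖S (v j)‖ ^ 2 + (256 * t : ℕ) * f t ^ 2) *
          ∑ j, x j ^ 2} with hB₂
  set B₃ := {G : Fin (256 * t) → Fin n → ℝ | ∃ j ∈ Finset.univ.filter fun j : Fin d => (j : ℕ) < n,
      G ∈ {G : Fin (256 * t) → Fin n → ℝ | ¬ ((256 * t : ℕ) / 2 * ‖S (v j)‖ ^ 2 ≤
        ‖Matrix.toEuclideanLin (Matrix.of G) (S (v j))‖ ^ 2 ∧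
      ‖Matrix.toEuclideanLin (Matrix.of G) (S (v j))‖ ^ 2 ≤
        2 * (256 * t : ℕ) * ‖S (v j)‖ ^ 2)}} with hB₃
  have hP₁ := measure_not_subspace_embedding_le (r := 256 * t) (t := t)
    ((coordSpan v {j | (j : ℕ) < t}).map S) (by
      refine (Submodule.finrank_map_le _ _).trans ?_
      rw [finrank_coordSpan_lt]
      exact min_le_right _ _)
  have hP₂ := measure_not_norm_sum_smul_le (r := 256 * t)
    (fun j : {j : Fin d // t ≤ (j : ℕ)} => S (v j))
    (fun i j hij => inner_map_rightSingularBasis_of_ne S hd fun h => hij (Subtype.ext h))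
    (S := f t) (fun j => by rw [hav]; exact hanti j.2)
  have hP₃ := measure_biUnion_finset_le_card_mul (gaussianMatrixLaw (256 * t) n 1)
    (Finset.univ.filter fun j : Fin d => (j : ℕ) < n) _ (m := n)
    (by rw [Fin.card_filter_val_lt]; exact min_le_right _ _)
    fun j _ => measure_norm_sq_not_mem_le (r := 256 * t) (S (v j))
  rw [← hB₁] at hP₁
  rw [← hB₂] at hP₂
  rw [← hB₃] at hP₃
  have hsum : gaussianMatrixLaw (256 * t) n 1 (B₁ ∪ B₂ ∪ B₃) ≤ ENNReal.ofReal (Real.exp (-t)) := by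
    refine (measure_union_le _ _).trans ((add_le_add ((measure_union_le _ _).trans
      (add_le_add hP₁ hP₂)) hP₃).trans ?_)
    rw [← ENNReal.ofReal_add (by positivity) (by positivity),
      ← ENNReal.ofReal_add (by positivity) (by positivity)]
    exact ENNReal.ofReal_le_ofReal (failure_probability_le ht hnt (ht.trans_le htn))
  refine (measure_mono fun G hG => ?_).trans hsum
  by_contra hcon
  simp only [Set.mem_union, not_or] at hcon
  obtain ⟨⟨hG₁, hG₂⟩, hG₃⟩ := hcon
  rw [hB₁, Set.mem_ofPred_eq, not_not] at hG₁
  rw [hB₂, Set.mem_ofPred_eq, not_not] at hG₂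
  set Γ := Matrix.toEuclideanLin (Matrix.of G) with hΓ
  have hcomp : Matrix.toEuclideanLin (Matrix.of G * A) = Γ ∘ₗ S := Matrix.toLpLin_mul_same _ _ _
  have hsqrt : √(256 * t : ℕ) = 16 * √t := by
    push_cast
    rw [Real.sqrt_mul (by norm_num), show (256 : ℝ) = 16 ^ 2 by norm_num,
      Real.sqrt_sq (by norm_num)]
  rw [hsqrt] at hG₁
  have h1 : ∀ x ∈ coordSpan v {j | (j : ℕ) < t},
      4 * √t * ‖S x‖ ≤ ‖Γ (S x)‖ ∧ ‖Γ (S x)‖ ≤ 32 * √t * ‖S x‖ := fun x hx => by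
    have := hG₁ (S x) (Submodule.mem_map_of_mem hx)
    exact ⟨le_trans (le_of_eq (by ring)) this.1, this.2.trans (le_of_eq (by ring))⟩
  set R := √(48 * (T ^ 2 + (256 * t : ℕ) * f t ^ 2)) with hR
  have hRle : R ≤ 7 * (T + 16 * (√t * f t)) := by
    have hft := hf t
    refine Real.sqrt_le_iff.2 ⟨by positivity, ?_⟩
    have hs := Real.sq_sqrt (Nat.cast_nonneg (α := ℝ) t)
    have h3 : 0 ≤ T * (√t * f t) := by positivity
    have h4 : (√t * f t) ^ 2 = t * f t ^ 2 := by rw [mul_pow, hs]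
    push_cast
    nlinarith [sq_nonneg T, sq_nonneg (√t * f t)]
  have h2 : ∀ x ∈ coordSpan v {j | t ≤ (j : ℕ)}, ‖Γ (S x)‖ ≤ R * ‖x‖ := fun x hx => by
    have hz : ∀ j : Fin d, ¬ t ≤ (j : ℕ) → inner ℝ (v j) x = 0 := fun j hj =>
      inner_eq_zero_of_mem_coordSpan v _ hx hj
    have e1 : Γ (S x) = ∑ j : {j : Fin d // t ≤ (j : ℕ)}, inner ℝ (v j) x • Γ (S (v j)) := by
      rw [sum_subtype_of_eq_zero (g := fun j => inner ℝ (v j) x • Γ (S (v j)))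
        fun j hj => by rw [hz j hj, zero_smul]]
      conv_lhs => rw [← v.sum_repr' x]
      simp only [map_sum, map_smul]
    have e2 : ∑ j : {j : Fin d // t ≤ (j : ℕ)}, inner ℝ (v j) x ^ 2 = ‖x‖ ^ 2 := by
      rw [sum_subtype_of_eq_zero (g := fun j => inner ℝ (v j) x ^ 2)
        fun j hj => by rw [hz j hj, zero_pow two_ne_zero], sum_sq_inner]
    have h := hG₂ fun j => inner ℝ (v j) x
    rw [← e1, e2, hTsq] at h
    refine (sq_le_sq₀ (norm_nonneg _) (by positivity)).1 (h.trans (le_of_eq ?_))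
    rw [mul_pow, hR, Real.sq_sqrt (by positivity)]
  have h3 : ∀ j, 128 * t * ‖S (v j)‖ ^ 2 ≤ ‖Γ (S (v j))‖ ^ 2 := fun j => by
    rcases le_or_gt n (j : ℕ) with hj | hj
    · rw [hav, hfn _ hj]
      simp
    · by_contra! h
      refine hG₃ ⟨j, by simpa using hj, fun h' => ?_⟩
      have := h'.1
      push_cast at this
      linarith
  obtain ⟨s', hs'0, hs'R, hs's, hs'sum⟩ := exists_le_singularValues_comp_tail S Γ hd
    (Real.sqrt_nonneg _) h2 (m := 256 * t) (by rw [finrank_euclideanSpace_fin])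
  refine hG fun q hq => ?_
  rw [schattenNorm_eq_finsetNorm hq _ (Matrix.rank_le_height (Matrix.of G * A)), hcomp]
  refine ⟨sketchSize_le_finsetNorm hq hf hanti (LinearMap.singularValues_nonneg _) hRle
    (fun i hi => mul_singularValues_le_singularValues_comp S Γ hd (by positivity)
      (fun x hx => (h1 x hx).1) hi) hs'0 hs'R hs's ?_,
    finsetNorm_le_sketchSize hq hf hanti (LinearMap.singularValues_nonneg _)
      (Real.sqrt_nonneg _) hRle
      (singularValues_comp_le_add S Γ hd (by positivity) (Real.sqrt_nonneg _)
        (fun x hx => (h1 x hx).2) h2)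
      fun i hi => singularValues_comp_le_of_le S Γ hd (Real.sqrt_nonneg _) h2 hi⟩
  rw [hs'sum, ← hT, ← hTsq, mul_sum]
  exact sum_le_sum fun j _ => h3 j

end Sketch

/-! ### Oblivious sketches -/

theorem gaussianMatrixLaw_sq_eq_map (r n : ℕ) (s : ℝ≥0) :
    gaussianMatrixLaw r n (s ^ 2) =
      (gaussianMatrixLaw r n 1).map fun G k l => (s : ℝ) * G k l := by
  have h0 : gaussianReal 0 (s ^ 2) = (gaussianReal 0 1).map fun x => (s : ℝ) * x := by
    rw [gaussianReal_map_const_mul, mul_zero, mul_one]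
    rfl
  unfold gaussianMatrixLaw
  rw [h0]
  have h1 : (Measure.pi fun _ : Fin n => (gaussianReal 0 1).map fun x => (s : ℝ) * x) =
      (Measure.pi fun _ : Fin n => gaussianReal 0 1).map fun g l => (s : ℝ) * g l :=
    have : ∀ _ : Fin n, SigmaFinite ((gaussianReal 0 1).map fun x => (s : ℝ) * x) :=
      fun _ => by rw [← h0]; infer_instance
    (Measure.pi_map_pi fun _ => by fun_prop).symm
  have h2 : IsProbabilityMeasure
      ((Measure.pi fun _ : Fin n => gaussianReal 0 1).map fun g l => (s : ℝ) * g l) :=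
    Measure.isProbabilityMeasure_map (Measurable.aemeasurable (by fun_prop))
  rw [h1]
  exact (Measure.pi_map_pi fun _ => Measurable.aemeasurable (by fun_prop)).symm

theorem schattenNorm_nonneg {m d : ℕ} (p : ℝ) (A : Matrix (Fin m) (Fin d) ℝ) :
    0 ≤ schattenNorm p A :=
  finsetNorm_nonneg (LinearMap.singularValues_nonneg _)

theorem IsObliviousSketch.mono {r n : ℕ} {μ : Measure (Fin r → Fin n → ℝ)} [IsFiniteMeasure μ]
    {p q D D' δ : ℝ} (h : IsObliviousSketch μ p q D δ) (hD : D ≤ D') :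
    IsObliviousSketch μ p q D' δ := fun d A =>
  (h d A).trans (measureReal_mono fun _ hG =>
    ⟨hG.1, hG.2.trans (mul_le_mul_of_nonneg_right hD (schattenNorm_nonneg p A))⟩)

/-- If `sketchSize` is between `a⁻¹` and `b` times the `ℓ_p` norm, a Gaussian matrix is an oblivious
sketch of distortion `O(a b)`. The standard deviation `500 a` is the one that turns the lower bound
of `measure_not_schattenNorm_comparable_le` into `‖A‖_p ≤ ‖G A‖_q`. -/
theorem isObliviousSketch_of_bounds {n t : ℕ} (ht : 0 < t) (htn : t ≤ n) (hnt : Real.log n ≤ t)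
    {p q : ℝ} (hp : 1 ≤ p) (hq : 1 ≤ q) {a b : ℝ} (ha : 0 < a)
    (h : ∀ f : ℕ → ℝ, (∀ i, 0 ≤ f i) → Antitone f →
      finsetNorm p (Finset.range n) f ≤ a * sketchSize q t n f ∧
      sketchSize q t n f ≤ b * finsetNorm p (Finset.range n) f) :
    IsObliviousSketch (gaussianMatrixLaw (256 * t) n ((500 * a).toNNReal ^ 2)) p q
      (15000000 * (a * b)) (Real.exp (-t)) := by
  intro d A
  obtain ⟨h1, h2⟩ := h (Matrix.toEuclideanLin A).singularValues
    (LinearMap.singularValues_nonneg _) (LinearMap.singularValues_antitone _)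
  rw [← schattenNorm_eq_finsetNorm hp A (Matrix.rank_le_height A)] at h1 h2
  have hs : ((500 * a).toNNReal : ℝ) = 500 * a := Real.coe_toNNReal _ (by positivity)
  have hs0 : (0 : ℝ) < 500 * a := by positivity
  set N := sketchSize q t n (Matrix.toEuclideanLin A).singularValues
  set Ω := {G : Fin (256 * t) → Fin n → ℝ | schattenNorm p A ≤ schattenNorm q (Matrix.of G * A) ∧
      schattenNorm q (Matrix.of G * A) ≤ 15000000 * (a * b) * schattenNorm p A} with hΩ
  rw [gaussianMatrixLaw_sq_eq_map]
  set μ := gaussianMatrixLaw (256 * t) n 1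
  set φ : (Fin (256 * t) → Fin n → ℝ) → Fin (256 * t) → Fin n → ℝ :=
    fun G k l => ((500 * a).toNNReal : ℝ) * G k l with hφ
  have hφm : Measurable φ := by fun_prop
  have hcompl : μ (φ ⁻¹' Ω)ᶜ ≤ ENNReal.ofReal (Real.exp (-t)) := by
    refine (measure_mono fun G hG => ?_).trans
      (measure_not_schattenNorm_comparable_le ht htn hnt A)
    intro hgood
    obtain ⟨h3, h4⟩ := hgood q hq
    refine hG ?_
    have h5 : schattenNorm q (Matrix.of (φ G) * A) =
        500 * a * schattenNorm q (Matrix.of G * A) := by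
      rw [← schattenNorm_smul hq _ hs0, ← Matrix.smul_mul]
      congr 2
      ext k l
      simp [hφ, hs]
    refine ⟨?_, ?_⟩
    · rw [h5]
      calc schattenNorm p A ≤ a * N := h1
        _ ≤ a * (500 * schattenNorm q (Matrix.of G * A)) := by gcongr
        _ = _ := by ring
    · rw [h5]
      calc 500 * a * schattenNorm q (Matrix.of G * A) ≤ 500 * a * (30000 * N) := by gcongr
        _ ≤ 500 * a * (30000 * (b * schattenNorm p A)) := by gcongr
        _ = _ := by ring
  have hprob : IsProbabilityMeasure (μ.map φ) := Measure.isProbabilityMeasure_map hφm.aemeasurable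
  have h6 : (1 : ENNReal) ≤ μ.map φ Ω + ENNReal.ofReal (Real.exp (-t)) := by
    calc (1 : ENNReal) = μ Set.univ := measure_univ.symm
      _ ≤ μ (φ ⁻¹' Ω) + μ (φ ⁻¹' Ω)ᶜ := by
        rw [← Set.union_compl_self (φ ⁻¹' Ω)]; exact measure_union_le _ _
      _ ≤ _ := add_le_add (Measure.le_map_apply hφm.aemeasurable Ω) hcompl
  have h7 := ENNReal.toReal_mono (by finiteness) h6
  rw [ENNReal.toReal_add (by finiteness) (by finiteness), ENNReal.toReal_one,
    ENNReal.toReal_ofReal (Real.exp_pos _).le] at h7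
  rw [Measure.real]
  linarith

theorem one_le_log_div {n t : ℕ} (ht : 0 < t) (htn : (t : ℝ) ≤ 1 / 3 * n) :
    1 ≤ Real.log ((n : ℝ) / t) := by
  have ht0 : (0 : ℝ) < t := Nat.cast_pos.2 ht
  have h3 : 3 ≤ (n : ℝ) / t := by rw [le_div_iff₀ ht0]; linarith
  rw [Real.le_log_iff_exp_le (by linarith)]
  exact Real.exp_one_lt_three.le.trans h3

/-- A variant of `isObliviousSketch_of_bounds` with the factor `log (n / t)` inserted. This factor
is at least `1` because `3 t ≤ n`, and the bound holds without it. -/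
theorem exists_isObliviousSketch {n t : ℕ} (ht : 0 < t) (htn : (t : ℝ) ≤ 1 / 3 * n)
    (hnt : Real.log n ≤ t) {p q D : ℝ} (hp : 1 ≤ p) (hq : 1 ≤ q) (hD : 0 ≤ D)
    (h : ∃ a b : ℝ, 0 < a ∧ a * b ≤ 4 * D ∧ ∀ f : ℕ → ℝ, (∀ i, 0 ≤ f i) → Antitone f →
      finsetNorm p (Finset.range n) f ≤ a * sketchSize q t n f ∧
      sketchSize q t n f ≤ b * finsetNorm p (Finset.range n) f) :
    ∃ v : ℝ≥0, 0 < v ∧ ∀ D', D ≤ D' → IsObliviousSketch (gaussianMatrixLaw (256 * t) n v) p q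
      (60000000 * D' * Real.log ((n : ℝ) / t)) (Real.exp (-1 * t)) := by
  obtain ⟨a, b, ha, hab, hf⟩ := h
  have htn' : t ≤ n := by
    have : (t : ℝ) ≤ n := by
      have : (0 : ℝ) ≤ n := Nat.cast_nonneg n
      linarith
    exact_mod_cast this
  refine ⟨(500 * a).toNNReal ^ 2, pow_pos (Real.toNNReal_pos.2 (by positivity)) 2,
    fun D' hD' => ?_⟩
  rw [neg_one_mul]
  refine (isObliviousSketch_of_bounds ht htn' hnt hp hq ha hf).mono ?_
  have hlog := one_le_log_div ht htn
  calc 15000000 * (a * b) ≤ 60000000 * D' * 1 := by linarith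
    _ ≤ _ := by
      have : 0 ≤ D' := hD.trans hD'
      gcongr

theorem mainTheorem2 :
    ∃ (θ c c'' : ℝ) (K : ℕ), 0 < θ ∧ θ < 1 ∧ 1 ≤ c ∧ 0 < c'' ∧ 1 ≤ K ∧
      ∀ p q : ℝ, 1 ≤ p → 1 ≤ q → ∃ C : ℝ, 0 < C ∧
        ∀ n t : ℕ, 0 < t → c * Real.log n ≤ t → (t : ℝ) ≤ θ * n →
          ∃ v : ℝ≥0, 0 < v ∧
            (p ≤ q → q ≤ 2 →
              IsObliviousSketch (gaussianMatrixLaw (K * t) n v) p q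
                (C * ((n : ℝ) ^ (1 / p - 1 / 2) / (t : ℝ) ^ (1 / q - 1 / 2)) *
                  Real.log ((n : ℝ) / t))
                (Real.exp (-c'' * t))) ∧
            (q ≤ p → p ≤ 2 →
              IsObliviousSketch (gaussianMatrixLaw (K * t) n v) p q
                (C * max (((n : ℝ) / t) ^ (1 / p - 1 / 2)) ((t : ℝ) ^ (1 / q - 1 / p)) *
                  Real.log ((n : ℝ) / t))
                (Real.exp (-c'' * t))) ∧
            (2 ≤ p → p ≤ q →
              IsObliviousSketch (gaussianMatrixLaw (K * t) n v) p q
                (C * max (((n : ℝ) / t) ^ (1 / 2 - 1 / p)) ((t : ℝ) ^ (1 / p - 1 / q)) *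
                  Real.log ((n : ℝ) / t))
                (Real.exp (-c'' * t))) ∧
            (2 ≤ q → q ≤ p →
              IsObliviousSketch (gaussianMatrixLaw (K * t) n v) p q
                (C * ((n : ℝ) ^ (1 / 2 - 1 / p) / (t : ℝ) ^ (1 / 2 - 1 / q)) *
                  Real.log ((n : ℝ) / t))
                (Real.exp (-c'' * t))) ∧
            (p = q →
              IsObliviousSketch (gaussianMatrixLaw (K * t) n v) p p
                (C * ((n : ℝ) / t) ^ |1 / p - 1 / 2| * Real.log ((n : ℝ) / t))
                (Real.exp (-c'' * t))) := by
  refine ⟨1 / 3, 1, 1, 256, by norm_num, by norm_num, le_rfl, one_pos, by norm_num,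
    fun p q hp hq => ⟨60000000, by norm_num, fun n t ht hnt htn => ?_⟩⟩
  rw [one_mul] at hnt
  have ht0 : (0 : ℝ) < t := Nat.cast_pos.2 ht
  have hn0 : (0 : ℝ) < n := by linarith
  have htn' : t ≤ n := by
    have : (t : ℝ) ≤ n := by linarith
    exact_mod_cast this
  rcases lt_trichotomy p q with hpq | rfl | hpq
  · rcases le_or_gt q 2 with hq2 | hq2
    · obtain ⟨v, hv, h⟩ := exists_isObliviousSketch ht htn hnt hp hq (by positivity)
        (sketchSize_bounds_of_le_of_le_two hp hpq.le hq2 ht htn')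
      exact ⟨v, hv, fun _ _ => h _ le_rfl, fun h => by linarith, fun h => by linarith,
        fun _ h => by linarith, fun h => by linarith⟩
    · rcases le_or_gt 2 p with hp2 | hp2
      · obtain ⟨v, hv, h⟩ := exists_isObliviousSketch ht htn hnt hp hq (by positivity)
          (sketchSize_bounds_of_two_le_of_le hp2 hpq.le ht htn')
        exact ⟨v, hv, fun _ h => by linarith, fun h => by linarith, fun _ _ => h _ le_rfl,
          fun _ h => by linarith, fun h => by linarith⟩
      · exact ⟨1, one_pos, fun _ h => by linarith, fun h => by linarith, fun h => by linarith,
          fun _ h => by linarith, fun h => by linarith⟩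
  · -- Several regimes apply at once to `p = q`, so one variance has to serve all of them; each of
    -- their distortions is at least `(n / t) ^ |1 / p - 1 / 2|`.
    have hdiv : ∀ e : ℝ, (n : ℝ) ^ e / (t : ℝ) ^ e = ((n : ℝ) / t) ^ e := fun e =>
      (Real.div_rpow hn0.le ht0.le e).symm
    have hp0 : 0 < p := by linarith
    rcases le_total p 2 with hp2 | hp2
    · obtain ⟨v, hv, h⟩ := exists_isObliviousSketch ht htn hnt hp hp (by positivity)
        (sketchSize_bounds_of_le_of_le_two hp le_rfl hp2 ht htn')
      rw [hdiv] at h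
      refine ⟨v, hv, fun _ _ => h _ (hdiv _).ge, fun _ _ => h _ (le_max_left _ _), fun h2 _ => ?_,
        fun h2 _ => ?_, fun _ => h _ ?_⟩
      · obtain rfl : p = 2 := le_antisymm hp2 h2
        exact h _ (le_max_left _ _)
      · obtain rfl : p = 2 := le_antisymm hp2 h2
        exact h _ (hdiv _).ge
      · rw [abs_of_nonneg (sub_nonneg.2 (one_div_le_one_div_of_le hp0 hp2))]
    · obtain ⟨v, hv, h⟩ := exists_isObliviousSketch ht htn hnt hp hp (by positivity)
        (sketchSize_bounds_of_two_le_of_ge hp2 le_rfl ht htn')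
      rw [hdiv] at h
      refine ⟨v, hv, fun _ h2 => ?_, fun _ h2 => ?_, fun _ _ => h _ (le_max_left _ _),
        fun _ _ => h _ (hdiv _).ge, fun _ => h _ ?_⟩
      · obtain rfl : p = 2 := le_antisymm h2 hp2
        exact h _ (hdiv _).ge
      · obtain rfl : p = 2 := le_antisymm h2 hp2
        exact h _ (le_max_left _ _)
      · rw [abs_sub_comm, abs_of_nonneg (sub_nonneg.2 (one_div_le_one_div_of_le two_pos hp2))]
  · rcases le_or_gt p 2 with hp2 | hp2
    · obtain ⟨v, hv, h⟩ := exists_isObliviousSketch ht htn hnt hp hq (by positivity)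
        (sketchSize_bounds_of_ge_of_le_two hq hpq.le hp2 ht htn')
      exact ⟨v, hv, fun h => by linarith, fun _ _ => h _ le_rfl, fun _ h => by linarith,
        fun h => by linarith, fun h => by linarith⟩
    · rcases le_or_gt 2 q with hq2 | hq2
      · obtain ⟨v, hv, h⟩ := exists_isObliviousSketch ht htn hnt hp hq (by positivity)
          (sketchSize_bounds_of_two_le_of_ge hq2 hpq.le ht htn')
        exact ⟨v, hv, fun h => by linarith, fun _ h => by linarith, fun _ h => by linarith,
          fun _ _ => h _ le_rfl, fun h => by linarith⟩
      · exact ⟨1, one_pos, fun h => by linarith, fun _ h => by linarith, fun _ h => by linarith,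
          fun h => by linarith, fun h => by linarith⟩
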